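/- Let $r\ge 1$ and $G=Sp_{2r}(\mathbb C)$, acting on the vector representation with basis $v_1,\dots,v_r,v_{\bar r},\dots,v_{\bar 1}$, indexed by the ordered set $J=\{1<\dots<r<\bar r<\dots<\bar 1\}$. The Chevalley generators act by $f_iv_i=v_{i+1}$, $f_iv_{\overline{i+1}}=v_{\bar i}$, $e_iv_{i+1}=v_i$, $e_iv_{\bar i}=v_{\overline{i+1}}$ $(1\le i<r)$, $f_rv_r=v_{\bar r}$, $e_rv_{\bar r}=v_r$ (all other actions being zero), and $h_i$ acts on $v_j$, $v_{\bar j}$ by $\pm(\delta_{ij}-\delta_{i,j-1})$ respectively; $G$ is the group preserving the symplectic form with $(v_j,v_{\bar j})=(-1)^{j-1}=-(v_{\bar j},v_j)$ and all other pairings of basis vectors zero. Let $H$, $N$, $N_-$ be the diagonal, upper unitriangular and lower unitriangular matrices in $G$. Put $x_i(t)=\exp(te_i)$, $y_i(t)=\exp(tf_i)$, $\alpha_i^\vee(t)=t^{h_i}$, $x_{-i}(t)=y_i(t)\alpha_i^\vee(t^{-1})$ and $\overline{s_i}=x_i(-1)y_i(1)x_i(-1)$; for a Weyl group element $w$ with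 reduced word $(j_1,\dots,j_l)$ let $\overline w=\overline{s_{j_1}}\cdots\overline{s_{j_l}}$. The generalized minor $\Delta_{w\Lambda_i,w'\Lambda_i}$ is the regular function on $G$ with $\Delta_{w\Lambda_i,w'\Lambda_i}(x)=a^{\Lambda_i}$ whenever $\overline w^{\,-1}x\,\overline{w'}=n_-\,a\,n_+$ with $n_-\in N_-$, $a\in H$, $n_+\in N$, where $\Lambda_i$ is the $i$-th fundamental weight. Let $1\le m\le r$, $1\le d\le r$, and let $\mathbf i=(i_1,\dots,i_n)=(1,\dots,r,\;\dots,\;1,\dots,r,\;1,\dots,d)$ ($m-1$ full cycles followed by $1,\dots,d$; $n=(m-1)r+d$), a reduced word of $u=(s_1\cdots s_r)^{m-1}s_1\cdots s_d$. Let $1\le k\le n$ with $i_k=i_n=d$, let $m'$ be the number of the cycle containing the position $k$ (that is, $(m'-1)r<k\le m'r$), let $u_{\le k}=s_{i_1}\cdots s_{i_k}$, and set $\Delta(k;\mathbf i)=\Delta_{u_{\le k}\Lambda_d,\Lambda_d}$. For $$\mathbf Y=(Y_{1,1},\dots,Y_{1,r},\dots,Y_{m-1,1},\dots,Y_{m-1,r},Y_{m,1},\dots,Y_{m,d})\in(\mathbb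 C^\times)^n$$ let $x^L_{\mathbf i}(\mathbf Y)=x_{-1}(Y_{1,1})\cdots x_{-r}(Y_{1,r})\cdots x_{-1}(Y_{m,1})\cdots x_{-d}(Y_{m,d})$ and $\Delta^L(k;\mathbf i)(\mathbf Y)=\Delta(k;\mathbf i)\bigl(x^L_{\mathbf i}(\mathbf Y)\bigr)$. With $Y_{s,0}=Y_{s,r+1}=1$, put $$\overline C(l,k)=\frac{Y_{l,k-1}}{Y_{l,k}},\qquad C(l,k)=\frac{Y_{l,k+1}}{Y_{l+1,k}},$$ and let $|j|=|\bar j|=j$ for $1\le j\le r$. Then $$\Delta^L(k;\mathbf i)(\mathbf Y)=\sum_{(*)}\ \prod_{i=1}^{d}\ \Bigl(\prod_{s=1}^{\delta_i}\overline C\bigl(m-l_i^{(s)},k_i^{(s)}\bigr)\Bigr)\Bigl(\prod_{s=\delta_i+1}^{m-m'}C\bigl(m-l_i^{(s)},|k_i^{(s)}|-1\bigr)\Bigr),$$ where the sum runs over all arrays $(k_i^{(s)})_{1\le s\le m-m',\,1\le i\le d}$ of elements of $J$ satisfying $$(*)\quad\begin{cases}k_1^{(s)}<k_2^{(s)}<\dots<k_d^{(s)}&(1\le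 s\le m-m'),\\ k_i^{(1)}\le\dots\le k_i^{(m-m')}&(1\le i\le d),\\ k_i^{(s)}\le m'+i&(1\le s\le m-m',\ 1\le i\le d,\ i\le r-m'),\end{cases}$$ $\delta_i$ is the number of $s$ with $k_i^{(s)}\in\{1,\dots,r\}$ (so $k_i^{(1)}\le\dots\le k_i^{(\delta_i)}\le r<\bar r\le k_i^{(\delta_i+1)}\le\dots\le k_i^{(m-m')}$), and $$l_i^{(s)}=\begin{cases}k_i^{(s)}+s-i-1&\text{if } s\le\delta_i,\\ s-i+r&\text{if } s>\delta_i.\end{cases}$$ In particular, $\Delta^L(k;\mathbf i)$ is a Laurent polynomial in the variables $Y_{s,l}$ with nonnegative integer coefficients. -/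

import Mathlib

open scoped Matrix

namespace TypeC

/-! The ordered set `J = {1 < 2 < ⋯ < r < r̄ < ⋯ < 2̄ < 1̄}` is modelled by `Fin (2 * r)` with its
usual order: the zero-based position `p < r` is the letter `p + 1`, and the position `2 r - j` is
the barred letter `j̄` (for `1 ≤ j ≤ r`). The index set `I = {1, …, r}` is `Fin r`, zero-based. -/

/-- The unbarred letter `i`. -/
def un {r : ℕ} (i : Fin r) : Fin (2 * r) := ⟨i.val, by omega⟩

/-- The barred letter `ī`. -/
def bar {r : ℕ} (i : Fin r) : Fin (2 * r) := ⟨2 * r - 1 - i.val, by omega⟩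

/-- The absolute value `|j| = |j̄| = j ∈ {1, …, r}` of a letter. -/
def letterAbs {r : ℕ} (p : Fin (2 * r)) : ℤ :=
  if p.val < r then (p.val : ℤ) + 1 else 2 * (r : ℤ) - p.val

/-- The matrix of `e_i` on the vector representation with basis `v_1, …, v_r, v_r̄, …, v_1̄`:
`e_i v_{i+1} = v_i`, `e_i v_ī = v_{(i+1)̄}` for `i < r`, and `e_r v_r̄ = v_r`. -/
def eMat {r : ℕ} (i : Fin r) : Matrix (Fin (2 * r)) (Fin (2 * r)) ℂ :=
  if h : i.val + 1 < r then
    Matrix.single (un i) (un ⟨i.val + 1, h⟩) 1 + Matrix.single (bar ⟨i.val + 1, h⟩) (bar i) 1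
  else Matrix.single (un i) (bar i) 1

/-- The matrix of `f_i`: `f_i v_i = v_{i+1}`, `f_i v_{(i+1)̄} = v_ī` for `i < r`, and
`f_r v_r = v_r̄`. -/
def fMat {r : ℕ} (i : Fin r) : Matrix (Fin (2 * r)) (Fin (2 * r)) ℂ :=
  if h : i.val + 1 < r then
    Matrix.single (un ⟨i.val + 1, h⟩) (un i) 1 + Matrix.single (bar i) (bar ⟨i.val + 1, h⟩) 1
  else Matrix.single (bar i) (un i) 1

/-- The eigenvalue `⟨h_i, wt(v_p)⟩` of the simple coroot `h_i` on the basis vector `v_p`, where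
`wt(v_j) = Λ_j - Λ_{j-1}` and `wt(v_j̄) = Λ_{j-1} - Λ_j`. -/
def corootWt {r : ℕ} (i : Fin r) (p : Fin (2 * r)) : ℤ :=
  if p.val < r then
    (if p.val = i.val then 1 else 0) - (if p.val = i.val + 1 then 1 else 0)
  else
    (if p.val + 1 + (i.val + 1) = 2 * r then 1 else 0) - (if p.val + 1 + i.val = 2 * r then 1 else 0)

/-- The Gram matrix of the symplectic form that is invariant under all `e_i`, `f_i`:
`(v_j, v_j̄) = (-1)^(j-1) = -(v_j̄, v_j)`, all other pairs of basis vectors being orthogonal. -/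
def sympForm (r : ℕ) : Matrix (Fin (2 * r)) (Fin (2 * r)) ℂ := fun p q =>
  if p.val + q.val + 1 = 2 * r then (if p.val < r then (-1) ^ p.val else -(-1) ^ q.val) else 0

/-- The group `Sp_{2r}(ℂ)`, in the basis `v_1, …, v_r, v_r̄, …, v_1̄`. -/
def Sp (r : ℕ) : Subgroup (GL (Fin (2 * r)) ℂ) where
  carrier := {g | (g.val)ᵀ * sympForm r * g.val = sympForm r}
  one_mem' := by simp
  mul_mem' := by
    intro a b ha hb
    simp only [Set.mem_ofPred_eq, Units.val_mul, Matrix.transpose_mul] at *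
    calc (b.val)ᵀ * (a.val)ᵀ * sympForm r * (a.val * b.val)
        = (b.val)ᵀ * ((a.val)ᵀ * sympForm r * a.val) * b.val := by simp only [Matrix.mul_assoc]
      _ = sympForm r := by rw [ha, hb]
  inv_mem' := by
    intro a ha
    simp only [Set.mem_ofPred_eq] at *
    have h1 : a.val * (a⁻¹).val = 1 := by simp
    have h2 : ((a⁻¹).val)ᵀ * (a.val)ᵀ = 1 := by rw [← Matrix.transpose_mul, h1]; simp
    calc ((a⁻¹).val)ᵀ * sympForm r * (a⁻¹).val
        = ((a⁻¹).val)ᵀ * ((a.val)ᵀ * sympForm r * a.val) * (a⁻¹).val := by rw [ha]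
      _ = (((a⁻¹).val)ᵀ * (a.val)ᵀ) * sympForm r * (a.val * (a⁻¹).val) := by
          simp only [Matrix.mul_assoc]
      _ = sympForm r := by rw [h1, h2]; simp

theorem sympForm_mul_self (r : ℕ) : sympForm r * sympForm r = -1 := by
  ext p q
  rw [Matrix.mul_apply, Finset.sum_eq_single p.rev]
  · have hp := p.isLt
    have hq := q.isLt
    have hr : p.rev.val = 2 * r - 1 - p.val := by rw [Fin.val_rev]; omega
    by_cases hpq : p = q
    · subst hpq
      rw [Matrix.neg_apply, Matrix.one_apply_eq]
      have h1 : p.val + p.rev.val + 1 = 2 * r := by omega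
      have h2 : p.rev.val + p.val + 1 = 2 * r := by omega
      by_cases h : p.val < r
      · have h3 : ¬ p.rev.val < r := by omega
        simp only [sympForm, if_pos h1, if_pos h2, if_pos h, if_neg h3]
        rw [mul_neg, ← mul_pow]; simp
      · have h3 : p.rev.val < r := by omega
        simp only [sympForm, if_pos h1, if_pos h2, if_neg h, if_pos h3]
        rw [neg_mul, ← mul_pow]; simp
    · have hpq' : p.val ≠ q.val := fun h => hpq (Fin.ext h)
      have h2 : ¬ (p.rev.val + q.val + 1 = 2 * r) := by omega
      rw [Matrix.neg_apply, Matrix.one_apply_ne hpq]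
      simp only [sympForm, if_neg h2, mul_zero, neg_zero]
  · intro x _ hx
    have : ¬ (p.val + x.val + 1 = 2 * r) := by
      intro h
      apply hx
      ext
      rw [Fin.val_rev]
      omega
    simp [sympForm, this]
  · simp

/-- A matrix that preserves the symplectic form, as an element of `Sp_{2r}(ℂ)`. -/
def toSp {r : ℕ} (A : Matrix (Fin (2 * r)) (Fin (2 * r)) ℂ)
    (hA : Aᵀ * sympForm r * A = sympForm r) : Sp r :=
  have h : (-(sympForm r * Aᵀ * sympForm r)) * A = 1 := by
    rw [Matrix.neg_mul, Matrix.mul_assoc, Matrix.mul_assoc, ← Matrix.mul_assoc Aᵀ, hA,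
      sympForm_mul_self, neg_neg]
  ⟨⟨A, -(sympForm r * Aᵀ * sympForm r), mul_eq_one_comm.mp h, h⟩, hA⟩

theorem eMat_sq {r : ℕ} (i : Fin r) : eMat i * eMat i = 0 := by
  have hi := i.isLt
  unfold eMat
  split_ifs with h
  · rw [Matrix.add_mul, Matrix.mul_add, Matrix.mul_add]
    rw [Matrix.single_mul_single_of_ne, Matrix.single_mul_single_of_ne,
      Matrix.single_mul_single_of_ne, Matrix.single_mul_single_of_ne]
    · simp
    all_goals simp only [un, bar, ne_eq, Fin.ext_iff]; omega
  · rw [Matrix.single_mul_single_of_ne]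
    simp only [un, bar, ne_eq, Fin.ext_iff]; omega

theorem fMat_eq_transpose {r : ℕ} (i : Fin r) : fMat i = (eMat i)ᵀ := by
  unfold fMat eMat
  split_ifs with h
  · simp [Matrix.transpose_add, Matrix.transpose_single]
  · simp [Matrix.transpose_single]

theorem fMat_sq {r : ℕ} (i : Fin r) : fMat i * fMat i = 0 := by
  rw [fMat_eq_transpose, ← Matrix.transpose_mul, eMat_sq, Matrix.transpose_zero]

theorem sympForm_transpose (r : ℕ) : (sympForm r)ᵀ = -sympForm r := by
  ext p q
  have hp := p.isLt
  have hq := q.isLt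
  simp only [sympForm, Matrix.transpose_apply, Matrix.neg_apply]
  by_cases h : p.val + q.val + 1 = 2 * r
  · rw [if_pos h, if_pos (by omega)]
    by_cases h' : p.val < r
    · rw [if_pos h', if_neg (by omega)]
    · rw [if_neg h', if_pos (by omega), neg_neg]
  · rw [if_neg h, if_neg (by omega), neg_zero]

theorem sympForm_mul_single {r : ℕ} (a b : Fin (2 * r)) (c : ℂ) :
    sympForm r * Matrix.single a b c
      = Matrix.single a.rev b (sympForm r a.rev a * c) := by
  ext p q
  by_cases hq : q = b
  · subst hq
    rw [Matrix.mul_single_apply_same]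
    by_cases hp : p = a.rev
    · subst hp; simp
    · rw [Matrix.single_apply_of_row_ne (Ne.symm hp)]
      have : ¬ (p.val + a.val + 1 = 2 * r) := by
        intro h; apply hp; ext; rw [Fin.val_rev]; omega
      simp [sympForm, this]
  · rw [Matrix.mul_single_apply_of_ne _ _ _ _ _ hq, Matrix.single_apply_of_col_ne _ _ (Ne.symm hq)]

theorem rev_un {r : ℕ} (i : Fin r) : (un i).rev = bar i := by
  ext; simp only [un, bar, Fin.val_rev]; omega

theorem rev_bar {r : ℕ} (i : Fin r) : (bar i).rev = un i := by
  ext; simp only [un, bar, Fin.val_rev]; omega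

theorem sympForm_bar_un {r : ℕ} (i : Fin r) : sympForm r (bar i) (un i) = -(-1) ^ i.val := by
  have := i.isLt
  have h1 : (un i).val = i.val := rfl
  have h2 : (bar i).val = 2 * r - 1 - i.val := rfl
  rw [sympForm, if_pos (by omega), if_neg (by omega), h1]

theorem sympForm_un_bar {r : ℕ} (i : Fin r) : sympForm r (un i) (bar i) = (-1) ^ i.val := by
  have := i.isLt
  have h1 : (un i).val = i.val := rfl
  have h2 : (bar i).val = 2 * r - 1 - i.val := rfl
  rw [sympForm, if_pos (by omega), if_pos (by omega), h1]

theorem sympForm_mul_eMat_transpose {r : ℕ} (i : Fin r) :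
    (sympForm r * eMat i)ᵀ = sympForm r * eMat i := by
  unfold eMat
  split_ifs with h
  · rw [Matrix.mul_add, sympForm_mul_single, sympForm_mul_single, rev_un, rev_bar,
      sympForm_bar_un, sympForm_un_bar, Matrix.transpose_add, Matrix.transpose_single,
      Matrix.transpose_single, add_comm]
    simp [pow_succ]
  · rw [sympForm_mul_single, rev_un, sympForm_bar_un, Matrix.transpose_single]

theorem sympForm_mul_fMat_transpose {r : ℕ} (i : Fin r) :
    (sympForm r * fMat i)ᵀ = sympForm r * fMat i := by
  unfold fMat
  split_ifs with h
  · rw [Matrix.mul_add, sympForm_mul_single, sympForm_mul_single, rev_un, rev_bar,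
      sympForm_bar_un, sympForm_un_bar, Matrix.transpose_add, Matrix.transpose_single,
      Matrix.transpose_single, add_comm]
    simp [pow_succ]
  · rw [sympForm_mul_single, rev_bar, sympForm_un_bar, Matrix.transpose_single]

theorem exp_of_sq_zero {n : Type*} [Fintype n] [DecidableEq n] (X : Matrix n n ℂ)
    (hX : X * X = 0) (t : ℂ) : IsNilpotent.exp (t • X) = 1 + t • X := by
  rw [IsNilpotent.exp_eq_sum (k := 2) (by rw [pow_two]; simp [hX])]
  simp [Finset.sum_range_succ]

theorem exp_mem {r : ℕ} (X : Matrix (Fin (2 * r)) (Fin (2 * r)) ℂ) (hX : X * X = 0)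
    (hs : (sympForm r * X)ᵀ = sympForm r * X) (t : ℂ) :
    (IsNilpotent.exp (t • X))ᵀ * sympForm r * IsNilpotent.exp (t • X) = sympForm r := by
  have h1 : Xᵀ * sympForm r = -(sympForm r * X) := by
    rw [Matrix.transpose_mul, sympForm_transpose, Matrix.mul_neg] at hs
    rw [← hs, neg_neg]
  rw [exp_of_sq_zero X hX]
  simp only [Matrix.transpose_add, Matrix.transpose_one, Matrix.transpose_smul, Matrix.add_mul,
    Matrix.mul_add, Matrix.one_mul, Matrix.mul_one, Matrix.smul_mul, Matrix.mul_smul, h1,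
    Matrix.neg_mul, Matrix.mul_assoc, hX, Matrix.mul_zero]
  simp

/-- `x_i(t) = exp(t e_i)`. -/
noncomputable def xPos {r : ℕ} (i : Fin r) (t : ℂ) : Sp r :=
  toSp (IsNilpotent.exp (t • eMat i)) (exp_mem _ (eMat_sq i) (sympForm_mul_eMat_transpose i) t)

/-- `y_i(t) = exp(t f_i)`. -/
noncomputable def yNeg {r : ℕ} (i : Fin r) (t : ℂ) : Sp r :=
  toSp (IsNilpotent.exp (t • fMat i)) (exp_mem _ (fMat_sq i) (sympForm_mul_fMat_transpose i) t)

theorem corootWt_add {r : ℕ} (i : Fin r) (p q : Fin (2 * r)) (h : p.val + q.val + 1 = 2 * r) :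
    corootWt i p + corootWt i q = 0 := by
  have := i.isLt
  simp only [corootWt]
  split_ifs <;> omega

theorem torus_mem {r : ℕ} (i : Fin r) (t : ℂˣ) :
    (Matrix.diagonal fun p => ((t ^ corootWt i p : ℂˣ) : ℂ))ᵀ * sympForm r *
      (Matrix.diagonal fun p => ((t ^ corootWt i p : ℂˣ) : ℂ)) = sympForm r := by
  ext p q
  rw [Matrix.diagonal_transpose, Matrix.mul_diagonal, Matrix.diagonal_mul]
  by_cases h : p.val + q.val + 1 = 2 * r
  · have h1 : ((t ^ corootWt i p : ℂˣ) : ℂ) * ((t ^ corootWt i q : ℂˣ) : ℂ) = 1 := by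
      rw [← Units.val_mul, ← _root_.zpow_add, corootWt_add i p q h]; simp
    rw [mul_right_comm, h1, one_mul]
  · simp [sympForm, h]

/-- `α_i^∨(t) = t^{h_i}`, the element acting on `v_p` by `t^⟨h_i, wt(v_p)⟩`. -/
noncomputable def coroot {r : ℕ} (i : Fin r) (t : ℂˣ) : Sp r :=
  toSp (Matrix.diagonal fun p => ((t ^ corootWt i p : ℂˣ) : ℂ)) (torus_mem i t)

/-- `x_{-i}(t) = y_i(t) α_i^∨(t⁻¹)`. -/
noncomputable def xNeg {r : ℕ} (i : Fin r) (t : ℂˣ) : Sp r := yNeg i t * coroot i t⁻¹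

/-- `x^L_𝐢(t_1, …, t_n) = x_{-i_1}(t_1) ⋯ x_{-i_n}(t_n)` for a word `𝐢 = (i_1, …, i_n)`. -/
noncomputable def xL {r : ℕ} (w : List (Fin r)) (Y : Fin w.length → ℂˣ) : Sp r :=
  (List.ofFn fun p => xNeg (w.get p) (Y p)).prod

/-- The representative `s̄_i = x_i(-1) y_i(1) x_i(-1)` of the simple reflection `s_i`. -/
noncomputable def sBar {r : ℕ} (i : Fin r) : Sp r := xPos i (-1) * yNeg i 1 * xPos i (-1)

/-- The representative `s̄_{i_1} ⋯ s̄_{i_l}` in the normalizer of `H` of the Weyl group element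
`s_{i_1} ⋯ s_{i_l}`, for a (reduced) word `(i_1, …, i_l)`. -/
noncomputable def weylRep {r : ℕ} (w : List (Fin r)) : Sp r := (w.map sBar).prod

/-- The entries of the matrix of `g` in the basis `v_1, …, v_r, v_r̄, …, v_1̄`. -/
def entry {r : ℕ} (g : Sp r) (p q : Fin (2 * r)) : ℂ := g.val.val p q

/-- The maximal torus `H`: the diagonal matrices in `Sp_{2r}(ℂ)`. -/
def torusH (r : ℕ) : Set (Sp r) := {g | ∀ p q, p ≠ q → entry g p q = 0}

/-- The subgroup `N`: the upper unitriangular matrices in `Sp_{2r}(ℂ)`. -/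
def unipN (r : ℕ) : Set (Sp r) :=
  {g | (∀ p, entry g p p = 1) ∧ ∀ p q, q < p → entry g p q = 0}

/-- The subgroup `N_-`: the lower unitriangular matrices in `Sp_{2r}(ℂ)`. -/
def unipNMinus (r : ℕ) : Set (Sp r) :=
  {g | (∀ p, entry g p p = 1) ∧ ∀ p q, p < q → entry g p q = 0}

/-- The character `a ↦ a^{Λ_i}` of `H`, for the fundamental weight
`Λ_i = wt(v_1) + ⋯ + wt(v_i)`. -/
def fundChar {r : ℕ} (i : Fin r) (a : Sp r) : ℂ := ∏ j ∈ Finset.Iic i, entry a (un j) (un j)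

/-- Regular functions on `Sp_{2r}(ℂ)`, a Zariski closed subset of the affine space of matrices:
the restrictions of polynomials in the matrix entries. -/
def IsRegularFun {r : ℕ} (D : Sp r → ℂ) : Prop :=
  ∃ P : MvPolynomial (Fin (2 * r) × Fin (2 * r)) ℂ,
    ∀ g : Sp r, D g = MvPolynomial.eval (fun pq => entry g pq.1 pq.2) P

/-- `D` is the generalized minor `Δ_{wΛ_i, w'Λ_i}`, where `w`, `w'` are given by reduced words: `D`
is a regular function on `G` such that `D x = ([w⁻¹ x w']_0)^{Λ_i}` for all `x` in
`w G_0 w'⁻¹`, where `G_0 = N_- H N` and `[n_- a n_+]_0 = a`. -/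
def IsGeneralizedMinor {r : ℕ} (w w' : List (Fin r)) (i : Fin r) (D : Sp r → ℂ) : Prop :=
  IsRegularFun D ∧
    ∀ x : Sp r, ∀ nm ∈ unipNMinus r, ∀ a ∈ torusH r, ∀ np ∈ unipN r,
      (weylRep w)⁻¹ * x * weylRep w' = nm * a * np → D x = fundChar i a

/-- The word `𝐢 = (1, …, r, 1, …, r, …, 1, …, r, 1, …, d)` with `m - 1` full cycles. -/
def cycWord (r m d : ℕ) : List (Fin r) :=
  (List.replicate (m - 1) (List.finRange r)).flatten ++ (List.finRange r).take d

/-- `D` is the function `Δ(k; 𝐢) = Δ_{u_{≤k} Λ_{i_k}, Λ_{i_k}}` on `G`, where `u_{≤k}` is the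
product of the first `k` letters of `𝐢`; the position `k` is zero-based here. -/
def IsInitialMinor {r : ℕ} (w : List (Fin r)) (k : Fin w.length) (D : Sp r → ℂ) : Prop :=
  IsGeneralizedMinor (w.take (k.val + 1)) [] (w.get k) D

/-- The coordinate `Y_{s,l}` of `𝐘 = (Y_{1,1}, …, Y_{1,r}, …, Y_{m,1}, …, Y_{m,d})`, with the
convention `Y_{s,0} = Y_{s,r+1} = 1` (and, for definiteness, `1` for all other indices at which
there is no coordinate). -/
noncomputable def Yc {r : ℕ} (w : List (Fin r)) (Y : Fin w.length → ℂˣ) (s l : ℤ) : ℂ :=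
  if h : 1 ≤ s ∧ 1 ≤ l ∧ l ≤ r ∧ (s - 1) * r + (l - 1) < w.length then
    ((Y ⟨((s - 1) * r + (l - 1)).toNat, by
      have h0 : 0 ≤ (s - 1) * (r : ℤ) := mul_nonneg (by omega) (by omega)
      omega⟩ : ℂˣ) : ℂ)
  else 1

/-- The Laurent monomial `C̄(l, k) = Y_{l,k-1} / Y_{l,k}`. -/
noncomputable def Cbar {r : ℕ} (w : List (Fin r)) (Y : Fin w.length → ℂˣ) (l k : ℤ) : ℂ :=
  Yc w Y l (k - 1) / Yc w Y l k

/-- The Laurent monomial `C(l, k) = Y_{l,k+1} / Y_{l+1,k}`. -/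
noncomputable def Cmon {r : ℕ} (w : List (Fin r)) (Y : Fin w.length → ℂˣ) (l k : ℤ) : ℂ :=
  Yc w Y l (k + 1) / Yc w Y (l + 1) k

/-! Arrays `(k_i^{(s)})`, `1 ≤ s ≤ M = m - m'`, `1 ≤ i ≤ d`, of letters of `J` are functions
`K : Fin M → Fin d → Fin (2 * r)`; the zero-based indices `s`, `i` stand for `s + 1`, `i + 1`. -/

/-- The conditions `(*)`: the rows are strictly increasing, the sequences
`k_i^{(1)} ≤ k_i^{(2)} ≤ ⋯` are weakly increasing, and `k_i^{(s)} ≤ m' + i` whenever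
`i ≤ r - m'`. -/
def StarCond (r m' M d : ℕ) (K : Fin M → Fin d → Fin (2 * r)) : Prop :=
  (∀ s, ∀ i j : Fin d, i < j → K s i < K s j) ∧
  (∀ i : Fin d, ∀ s t : Fin M, s ≤ t → K s i ≤ K t i) ∧
  (∀ i : Fin d, (i.val + 1) + m' ≤ r → ∀ s, (K s i).val + 1 ≤ m' + (i.val + 1))

instance instDecidableStarCond (r m' M d : ℕ) : DecidablePred (StarCond r m' M d) := fun _ => by
  unfold StarCond; infer_instance

/-- `δ_i`, the number of `s` such that `k_i^{(s)}` is unbarred; under `(*)` this is the number with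
`1 ≤ k_i^{(1)} ≤ ⋯ ≤ k_i^{(δ_i)} ≤ r < r̄ ≤ k_i^{(δ_i+1)} ≤ ⋯ ≤ 1̄`. -/
def delta {r M d : ℕ} (K : Fin M → Fin d → Fin (2 * r)) (i : Fin d) : ℕ :=
  (Finset.univ.filter fun s : Fin M => (K s i).val < r).card

/-- `l_i^{(s)} = k_i^{(s)} + s - i - 1` if `s ≤ δ_i`, and `s - i + r` if `s > δ_i`. -/
def ell {r M d : ℕ} (K : Fin M → Fin d → Fin (2 * r)) (s : Fin M) (i : Fin d) : ℤ :=
  if s.val + 1 ≤ delta K i then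
    letterAbs (K s i) + ((s.val : ℤ) + 1) - ((i.val : ℤ) + 1) - 1
  else ((s.val : ℤ) + 1) - ((i.val : ℤ) + 1) + r

/-- The Laurent monomial attached to an array: the product over `i` of
`C̄(m - l_i^{(s)}, k_i^{(s)})` for `s ≤ δ_i` and of `C(m - l_i^{(s)}, |k_i^{(s)}| - 1)` for
`s > δ_i`. -/
noncomputable def arrayMonomial {r : ℕ} (m : ℕ) (w : List (Fin r)) (Y : Fin w.length → ℂˣ)
    {M d : ℕ} (K : Fin M → Fin d → Fin (2 * r)) : ℂ :=
  ∏ i : Fin d, ∏ s : Fin M,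
    if s.val + 1 ≤ delta K i then Cbar w Y ((m : ℤ) - ell K s i) (letterAbs (K s i))
    else Cmon w Y ((m : ℤ) - ell K s i) (letterAbs (K s i) - 1)

/-- `F` is a Laurent polynomial with nonnegative integer coefficients, as a function on
`(ℂˣ)^n`. -/
def IsNonnegLaurent {n : ℕ} (F : (Fin n → ℂˣ) → ℂ) : Prop :=
  ∃ P : (Fin n → ℤ) →₀ ℕ, ∀ Y : Fin n → ℂˣ,
    F Y = P.sum fun e c => (c : ℂ) * ∏ p, ((Y p ^ e p : ℂˣ) : ℂ)

end TypeC

open TypeC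

/-!
The function `Δ(k; 𝐢)` is a leading `d × d` minor of `w̄⁻¹ x`, where `w = u_{≤k}`. Undoing the
letters of `w` one at a time moves the rows of this minor, without any sign, from `1, …, d` to the
extremal rows `target`: row `i` moves `m'` steps along `v_1 → ⋯ → v_r → v_r̄ → ⋯ → v_1̄`, except
that the rows passing `r` end packed at the bottom (`rowMinor_weylRep_inv_mul`). So `Δ^L(k; 𝐢)` is
the minor of `x^L_𝐢(𝐘)` with rows `target` and columns `1, …, d` (`rowMinor_xL` and
`arraySum_target` evaluate it).

For that minor, multiply out `x^L_𝐢(𝐘)` from the right. On rows, `x_{-i}(Y)` consists of the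
elementary operations `rowOp a Y` (row `a` is divided by `Y`, row `a + 1` is multiplied by `Y`, and
the old row `a` is added to it) at the one or two positions `a` with out-going letter `i`. A minor
with rows `T` thus counts `d` nonintersecting particles at the positions `T`: at each operation at
its position, a particle stays or moves one step. If `M a` denotes the number of operations done at
`a`, normalized by subtracting `min(a, r - 1)`, then operations at `a` happen exactly when `M a`
may grow to keep `M` weakly decreasing (`CanGrow`), like adding a box to a partition. A particle
`i` standing at `a` has stayed exactly `M a + i` times, whatever its history. Recording the
positions at which particle `i` stays, in order, as the column `i` of an array identifies particle
histories with the arrays `IsPartialArray`, and turns noncrossing into strictly increasing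
rows. A stay number `s` of the particle `i` (both counted from `0`) at `a` is due to the operation
that finds `M a = s - i`, so its weight depends only on `a` and `s - i`: this is where the monomials
`C̄` and `C` come from. One operation changes one column by at most one entry, which gives the
recursion `rowMinor_rowOp_eq_arraySum`.

After the last letter, column `i` has `m - m'` entries, or more if its particle ends barred; the
surplus entries are forced to equal the end position, and their weights telescope to `1`
(`IsPartialArray.eq_target`, `prod_forced`). What is left are the arrays `(*)`.

A generalized minor is prescribed only on the open cell. To evaluate it at `x^L_𝐢(𝐘)`, scale all
unipotent parameters of `w̄⁻¹ x^L_𝐢(𝐘)` by `t`. At `t = 0` the result lies in the torus, so for all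
but finitely many `t` it has nonzero leading minors, hence a Gauss decomposition inside the
symplectic group (`exists_gauss_decomposition`); two regular functions that agree on the cell
therefore agree as polynomials in `t`, in particular at `t = 1` (`regular_eq_of_contractsToTorus`).
-/

namespace TypeC

/-! ### Minors under elementary row operations, and arrays of stays -/

/-- The record `K` of the stays of `d` nonintersecting particles that are at the positions `T` when
the operations counted by `M` have been done: `K (i, s)` is the position of the stay number `s` of
the particle `i`. Column `i` has `M (T i) + i` entries and is padded by `0`. If the operation at
`T i - 1` has not been applied since the last one at `T i`, then the particle `i` cannot have
arrived since, so its last stay was at `T i` (`last`). -/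
structure IsPartialArray {d N : ℕ} (M : ℕ → ℤ) (T : Fin d → ℕ) (K : Fin d × Fin N → ℕ) :
    Prop where
  count_nonneg : ∀ i, 0 ≤ M (T i) + i.val
  le_pos : ∀ i (s : Fin N), (s.val : ℤ) < M (T i) + i.val → K (i, s) ≤ T i
  eq_zero : ∀ i (s : Fin N), M (T i) + i.val ≤ s.val → K (i, s) = 0
  mono : ∀ i (s t : Fin N), s ≤ t → (t.val : ℤ) < M (T i) + i.val → K (i, s) ≤ K (i, t)
  strict : ∀ i j : Fin d, i.val + 1 = j.val → ∀ s : Fin N, (s.val : ℤ) < M (T i) + i.val →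
    (s.val : ℤ) < M (T j) + j.val → K (i, s) < K (j, s)
  last : ∀ i b, T i = b + 1 → M b = M (b + 1) →
    ∃ s : Fin N, (s.val : ℤ) + 1 = M (T i) + i.val ∧ K (i, s) = T i

open Classical in
/-- The finite set of records with columns of length at most `N`, for positions `T i < L`. -/
noncomputable def partialArrays {d : ℕ} (L N : ℕ) (M : ℕ → ℤ) (T : Fin d → ℕ) :
    Finset (Fin d × Fin N → ℕ) :=
  (Fintype.piFinset fun _ => Finset.range L).filter (IsPartialArray M T)

/-- The weight of a stay at position `a` by the operation that raises `M a` from `h` to `h + 1`: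
the operation itself contributes `(z (a + 1) h)⁻¹`, and the next operation at `a - 1`, which finds
the particle waiting at `a`, contributes `z a (h + 1)`. -/
noncomputable def stayWt (z : ℕ → ℤ → ℂ) (a : ℕ) (h : ℤ) : ℂ := z a (h + 1) / z (a + 1) h

/-- The product of the weights of all recorded stays. -/
noncomputable def arrayWt {d N : ℕ} (z : ℕ → ℤ → ℂ) (M : ℕ → ℤ) (T : Fin d → ℕ)
    (K : Fin d × Fin N → ℕ) : ℂ :=
  ∏ p : Fin d × Fin N,
    if (p.2.val : ℤ) < M (T p.1) + p.1.val then stayWt z (K p) (p.2.val - p.1.val) else 1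

/-- The correction to `arrayWt` for a particle at the given position: if the operation below it has
not been applied since the last stay, the factor `z a (h + 1)` of that stay is still pending. -/
noncomputable def pendingWt (z : ℕ → ℤ → ℂ) (M : ℕ → ℤ) : ℕ → ℂ
  | 0 => 1
  | b + 1 => if M b = M (b + 1) then (z (b + 1) (M (b + 1)))⁻¹ else 1

/-- The total weight of all histories that lead to the positions `T`. -/
noncomputable def arraySum {d : ℕ} (L N : ℕ) (z : ℕ → ℤ → ℂ) (M : ℕ → ℤ) (T : Fin d → ℕ) : ℂ :=
  (∏ i, pendingWt z M (T i)) * ∑ K ∈ partialArrays L N M T, arrayWt z M T K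

theorem mem_partialArrays {d L N : ℕ} {M : ℕ → ℤ} {T : Fin d → ℕ} (hT : ∀ i, T i < L)
    {K : Fin d × Fin N → ℕ} : K ∈ partialArrays L N M T ↔ IsPartialArray M T K := by
  classical
  unfold partialArrays
  rw [Finset.mem_filter, Fintype.mem_piFinset]
  refine ⟨fun h => h.2, fun h => ⟨fun p => ?_, h⟩⟩
  rw [Finset.mem_range]
  obtain ⟨i, s⟩ := p
  have := hT i
  by_cases hs : (s.val : ℤ) < M (T i) + i.val
  · exact (h.le_pos i s hs).trans_lt this
  · rw [h.eq_zero i s (by omega)]; omega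

theorem IsPartialArray.congr {d N : ℕ} {M M' : ℕ → ℤ} {T : Fin d → ℕ}
    (h : ∀ i, M' (T i) = M (T i))
    (hl : ∀ i b, T i = b + 1 → (M' b = M' (b + 1) ↔ M b = M (b + 1)))
    (K : Fin d × Fin N → ℕ) : IsPartialArray M' T K ↔ IsPartialArray M T K := by
  constructor
  · rintro ⟨h1, h2, h3, h4, h5, h6⟩
    simp only [h] at h1 h2 h3 h4 h5 h6
    exact ⟨h1, h2, h3, h4, h5, fun i b hb hM => h6 i b hb ((hl i b hb).2 hM)⟩
  · rintro ⟨h1, h2, h3, h4, h5, h6⟩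
    simp only [← h] at h1 h2 h3 h4 h5 h6
    exact ⟨h1, h2, h3, h4, h5, fun i b hb hM => h6 i b hb ((hl i b hb).1 hM)⟩

theorem pendingWt_congr {z : ℕ → ℤ → ℂ} {M M' : ℕ → ℤ} {c : ℕ} (h : M' c = M c)
    (hl : ∀ b, c = b + 1 → (M' b = M' (b + 1) ↔ M b = M (b + 1))) :
    pendingWt z M' c = pendingWt z M c := by
  cases c with
  | zero => rfl
  | succ b =>
    have := hl b rfl
    rw [h] at this
    simp only [pendingWt, this, h]

theorem arraySum_congr {d L N : ℕ} {z : ℕ → ℤ → ℂ} {M M' : ℕ → ℤ} {T : Fin d → ℕ}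
    (h : ∀ i, M' (T i) = M (T i))
    (hl : ∀ i b, T i = b + 1 → (M' b = M' (b + 1) ↔ M b = M (b + 1))) :
    arraySum L N z M' T = arraySum L N z M T := by
  unfold arraySum
  congr 1
  · exact Finset.prod_congr rfl fun i _ => pendingWt_congr (h i) (hl i)
  · have : partialArrays L N M' T = partialArrays L N M T := by
      ext K
      simp only [partialArrays, Finset.mem_filter, IsPartialArray.congr h hl K]
    rw [this]
    refine Finset.sum_congr rfl fun K _ => ?_
    simp only [arrayWt, h]

/-- The operation at position `a` may be applied to `M`: it keeps `M` weakly decreasing on the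
positions `< L` and of slope at most one at `a`. The bound makes room for the additional entry in
columns of length at most `N`. -/
structure CanGrow (L d N : ℕ) (M : ℕ → ℤ) (a : ℕ) : Prop where
  lt : a < L
  anti : ∀ b c, b ≤ c → c < L → M c ≤ M b
  next : a + 1 < L → M a = M (a + 1)
  prev : ∀ b, b + 1 = a → M b = M a + 1
  zero : 0 ≤ M 0
  bound : M a + d ≤ N

theorem arraySum_grow_of_notMem {d L N : ℕ} {z : ℕ → ℤ → ℂ} {M : ℕ → ℤ} {a : ℕ}
    {T : Fin d → ℕ} (h1 : ∀ i, T i ≠ a) (h2 : ∀ i, T i ≠ a + 1) :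
    arraySum L N z (Function.update M a (M a + 1)) T = arraySum L N z M T := by
  refine arraySum_congr (fun i => Function.update_of_ne (h1 i) _ _) fun i b hb => ?_
  have := h1 i
  have := h2 i
  rw [Function.update_of_ne (by omega), Function.update_of_ne (by omega)]

/-- A particle at `a` just after an operation at `a` stayed there, so it had a nonnegative number of
stays before. -/
theorem count_nonneg_of_grow {d L N : ℕ} {M : ℕ → ℤ} {a : ℕ} (hg : CanGrow L d N M a)
    {T : Fin d → ℕ} {i : Fin d} (hi : T i = a)
    {K : Fin d × Fin N → ℕ} (hK : IsPartialArray (Function.update M a (M a + 1)) T K) :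
    0 ≤ M a + i.val := by
  rcases Nat.eq_zero_or_pos a with h | h
  · subst h
    have := hg.zero
    omega
  · obtain ⟨s, hs, -⟩ := hK.last i (a - 1) (by omega) (by
      have := hg.prev (a - 1) (by omega)
      rw [Function.update_of_ne (by omega), show a - 1 + 1 = a by omega,
        Function.update_self, this])
    rw [hi, Function.update_self] at hs
    omega

/-- When the operation at `a` meets a particle at `a` that is still there afterwards, the entry `a` is
appended to its column, and nothing else changes. -/
theorem isPartialArray_update_iff {d L N : ℕ} {M : ℕ → ℤ} {a : ℕ} (hg : CanGrow L d N M a)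
    {T : Fin d → ℕ} (hT : StrictMono T) (hTL : ∀ i, T i < L) {i : Fin d} (hi : T i = a)
    {n : Fin N} (hn : (n.val : ℤ) = M a + i.val)
    (K : Fin d × Fin N → ℕ) (hK : K (i, n) = 0) :
    IsPartialArray (Function.update M a (M a + 1)) T (Function.update K (i, n) a) ↔
      IsPartialArray M T K := by
  have hM : ∀ j, j ≠ i → Function.update M a (M a + 1) (T j) = M (T j) := fun j hj =>
    Function.update_of_ne (fun h => hj (hT.injective (h.trans hi.symm))) _ _
  have hMi : Function.update M a (M a + 1) (T i) = M (T i) + 1 := by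
    rw [hi, Function.update_self]
  have hU : ∀ j s, (j ≠ i ∨ s ≠ n) → Function.update K (i, n) a (j, s) = K (j, s) := by
    intro j s h
    refine Function.update_of_ne ?_ _ _
    rintro h'
    rw [Prod.mk.injEq] at h'
    tauto
  have hUi : Function.update K (i, n) a (i, n) = a := Function.update_self _ _ _
  have hlast : ∀ j b, j ≠ i → T j = b + 1 → b ≠ a →
      (Function.update M a (M a + 1) b = Function.update M a (M a + 1) (b + 1) ↔
        M b = M (b + 1)) := by
    intro j b hj hb hba
    have h1 := hM j hj
    rw [hb] at h1
    rw [h1, Function.update_of_ne hba]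
  constructor
  · rintro ⟨h1, h2, h3, h4, h5, h6⟩
    have hMn : M (T i) + i.val = n.val := by rw [hi, hn]
    refine ⟨fun j => ?_, fun j s hs => ?_, fun j s hs => ?_, fun j s t hst ht => ?_,
      fun j k hjk s hs hs' => ?_, fun j b hb hMb => ?_⟩
    · by_cases hj : j = i
      · subst hj; omega
      · have := h1 j; rwa [hM j hj] at this
    · have := h2 j s
      by_cases hj : j = i
      · subst hj
        rw [hU _ _ (Or.inr (by rintro rfl; omega)), hMi] at this
        exact this (by omega)
      · rw [hU _ _ (Or.inl hj), hM j hj] at this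
        exact this hs
    · by_cases hj : j = i
      · subst hj
        by_cases hsn : s = n
        · subst hsn; exact hK
        · have h := h3 j s
          rw [hU _ _ (Or.inr hsn), hMi] at h
          have : s.val ≠ n.val := fun h => hsn (Fin.ext h)
          exact h (by omega)
      · have := h3 j s
        rw [hU _ _ (Or.inl hj), hM j hj] at this
        exact this hs
    · have h := h4 j s t hst
      by_cases hj : j = i
      · subst hj
        have : s.val ≤ t.val := hst
        rw [hU _ _ (Or.inr (by rintro rfl; omega)), hU _ _ (Or.inr (by rintro rfl; omega)),
          hMi] at h
        exact h (by omega)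
      · rw [hU _ _ (Or.inl hj), hU _ _ (Or.inl hj), hM j hj] at h
        exact h ht
    · have h := h5 j k hjk s
      have hor : ∀ l, (s.val : ℤ) < M (T l) + l.val → (l ≠ i ∨ s ≠ n) := by
        intro l hl
        by_cases hli : l = i
        · subst hli
          right; rintro rfl; omega
        · exact Or.inl hli
      have hle : ∀ l, M (T l) ≤ Function.update M a (M a + 1) (T l) := by
        intro l
        by_cases hli : l = i
        · subst hli; omega
        · rw [hM l hli]
      rw [hU _ _ (hor j hs), hU _ _ (hor k hs')] at h
      have := hle j
      have := hle k
      exact h (by omega) (by omega)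
    · have hji : j ≠ i := by
        rintro rfl
        have := hg.prev b (by omega)
        rw [show b + 1 = a by omega] at hMb
        omega
      by_cases hba : b = a
      · -- the next particle waits right above position `a`
        subst hba
        have hjv : j.val = i.val + 1 := by
          have h1 : i < j := by rw [← hT.lt_iff_lt]; omega
          by_contra hne
          have h2 : i.val < j.val := h1
          let k : Fin d := ⟨i.val + 1, by omega⟩
          have h3 : T i < T k := hT (by simp [k, Fin.lt_def])
          have h4 : T k < T j := hT (by simp only [k, Fin.lt_def]; omega)
          omega
        refine ⟨n, ?_, ?_⟩
        · rw [hb, ← hMb, hn, hjv]; push_cast; ring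
        · have h := h5 i j hjv.symm n
          rw [hUi, hU _ _ (Or.inl hji), hMi, hM j hji, hb, ← hMb] at h
          have h' := h2 j n
          rw [hU _ _ (Or.inl hji), hM j hji, hb, ← hMb] at h'
          have := h (by omega) (by omega)
          have := h' (by omega)
          omega
      · obtain ⟨s, hs, hs'⟩ := h6 j b hb ((hlast j b hji hb hba).2 hMb)
        rw [hM j hji] at hs
        rw [hU _ _ (Or.inl hji)] at hs'
        exact ⟨s, hs, hs'⟩
  · rintro ⟨h1, h2, h3, h4, h5, h6⟩
    have hMn : M (T i) + i.val = n.val := by rw [hi, hn]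
    refine ⟨fun j => ?_, fun j s hs => ?_, fun j s hs => ?_, fun j s t hst ht => ?_,
      fun j k hjk s hs hs' => ?_, fun j b hb hMb => ?_⟩
    · by_cases hj : j = i
      · subst hj; rw [hMi]; have := h1 j; omega
      · rw [hM j hj]; exact h1 j
    · by_cases hj : j = i
      · subst hj
        by_cases hsn : s = n
        · subst hsn; rw [hUi, hi]
        · rw [hU _ _ (Or.inr hsn)]
          have : s.val ≠ n.val := fun h => hsn (Fin.ext h)
          exact h2 j s (by omega)
      · rw [hU _ _ (Or.inl hj)]
        rw [hM j hj] at hs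
        exact h2 j s hs
    · by_cases hj : j = i
      · subst hj
        rw [hU _ _ (Or.inr (by rintro rfl; omega))]
        exact h3 j s (by omega)
      · rw [hU _ _ (Or.inl hj)]
        rw [hM j hj] at hs
        exact h3 j s hs
    · have hst' : s.val ≤ t.val := hst
      by_cases hj : j = i
      · subst hj
        by_cases htn : t = n
        · subst htn
          by_cases hsn : s = t
          · rw [hsn]
          · have : s.val ≠ t.val := fun h => hsn (Fin.ext h)
            rw [hUi, hU _ _ (Or.inr hsn), ← hi]
            exact h2 j s (by omega)
        · have : t.val ≠ n.val := fun h => htn (Fin.ext h)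
          rw [hU _ _ (Or.inr htn), hU _ _ (Or.inr (by rintro rfl; omega))]
          exact h4 j s t hst (by omega)
      · rw [hM j hj] at ht
        rw [hU _ _ (Or.inl hj), hU _ _ (Or.inl hj)]
        exact h4 j s t hst ht
    · have hlt : T j < T k := hT (by rw [Fin.lt_def]; omega)
      by_cases hsn : s = n
      · subst hsn
        by_cases hj : j = i
        · subst hj
          have hk : k ≠ j := by rintro rfl; omega
          rw [hUi, hU _ _ (Or.inl hk)]
          rw [hM k hk] at hs'
          -- the compared entry of the next column is its last one, and that particle waits
          have hk1 : T k = (T k - 1) + 1 := by omega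
          have e1 := hg.anti (a + 1) (T k) (by omega) (hTL k)
          have e2 := hg.anti (T k - 1) (T k) (by omega) (hTL k)
          have e3 := hg.anti a (T k - 1) (by omega) (by have := hTL k; omega)
          have e4 := hg.next (by have := hTL k; omega)
          obtain ⟨s', hs1, hs2⟩ := h6 k (T k - 1) hk1 (by rw [← hk1]; omega)
          have : s' = s := Fin.ext (by omega)
          subst this
          rw [hs2]; omega
        · by_cases hk : k = i
          · subst hk
            rw [hUi, hU _ _ (Or.inl hj)]
            rw [hM j hj] at hs
            have := h2 j s hs
            omega
          · rw [hU _ _ (Or.inl hj), hU _ _ (Or.inl hk)]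
            rw [hM j hj] at hs
            rw [hM k hk] at hs'
            exact h5 j k hjk s hs hs'
      · rw [hU _ _ (Or.inr hsn), hU _ _ (Or.inr hsn)]
        have hne : s.val ≠ n.val := fun h => hsn (Fin.ext h)
        have hor : ∀ l, (s.val : ℤ) < Function.update M a (M a + 1) (T l) + l.val →
            (s.val : ℤ) < M (T l) + l.val := by
          intro l hl
          by_cases hli : l = i
          · subst hli; omega
          · rwa [hM l hli] at hl
        exact h5 j k hjk s (hor j hs) (hor k hs')
    · by_cases hj : j = i
      · subst hj
        exact ⟨n, by omega, by rw [hUi, hi]⟩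
      · by_cases hba : b = a
        · subst hba
          have h := hM j hj
          rw [hb] at h
          rw [h, Function.update_self] at hMb
          have := hg.next (by have := hTL j; omega)
          omega
        · obtain ⟨s, hs, hs'⟩ := h6 j b hb ((hlast j b hj hb hba).1 hMb)
          exact ⟨s, by rw [hM j hj, hs], by rw [hU _ _ (Or.inl hj), hs']⟩

theorem entry_eq_of_grow {d L N : ℕ} {M : ℕ → ℤ} {a : ℕ} (hg : CanGrow L d N M a)
    {T : Fin d → ℕ} {i : Fin d} (hi : T i = a) {n : Fin N} (hn : (n.val : ℤ) = M a + i.val)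
    {K : Fin d × Fin N → ℕ} (hK : IsPartialArray (Function.update M a (M a + 1)) T K) :
    K (i, n) = a := by
  have hc : Function.update M a (M a + 1) (T i) = M a + 1 := by
    rw [hi, Function.update_self]
  rcases Nat.eq_zero_or_pos a with h | h
  · have := hK.le_pos i n (by rw [hc]; omega)
    omega
  · obtain ⟨s, hs, hs'⟩ := hK.last i (a - 1) (by omega) (by
      have := hg.prev (a - 1) (by omega)
      rw [Function.update_of_ne (by omega), show a - 1 + 1 = a by omega,
        Function.update_self, this])
    rw [hc] at hs
    rw [← hi, ← hs']
    congr 2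
    exact Fin.ext (by omega)

theorem sum_arrayWt_grow {d L N : ℕ} {z : ℕ → ℤ → ℂ} {M : ℕ → ℤ} {a : ℕ}
    (hg : CanGrow L d N M a) {T : Fin d → ℕ} (hT : StrictMono T) (hTL : ∀ i, T i < L)
    {i : Fin d} (hi : T i = a) :
    ∑ K ∈ partialArrays L N (Function.update M a (M a + 1)) T,
        arrayWt z (Function.update M a (M a + 1)) T K =
      stayWt z a (M a) * ∑ K ∈ partialArrays L N M T, arrayWt z M T K := by
  by_cases hn : 0 ≤ M a + i.val
  swap
  · have e1 : partialArrays L N (Function.update M a (M a + 1)) T = ∅ := by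
      rw [Finset.eq_empty_iff_forall_notMem]
      intro K hK
      exact hn (count_nonneg_of_grow hg hi ((mem_partialArrays hTL).1 hK))
    have e2 : partialArrays L N M T = ∅ := by
      rw [Finset.eq_empty_iff_forall_notMem]
      intro K hK
      have := ((mem_partialArrays hTL).1 hK).count_nonneg i
      rw [hi] at this
      exact hn this
    rw [e1, e2]; simp
  have hb := hg.bound
  have hid := i.isLt
  obtain ⟨n, hn'⟩ : ∃ n : Fin N, (n.val : ℤ) = M a + i.val :=
    ⟨⟨(M a + i.val).toNat, by omega⟩, by simp [hn]⟩
  rw [Finset.mul_sum]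
  refine (Finset.sum_bij' (fun K _ => Function.update K (i, n) a)
    (fun K _ => Function.update K (i, n) 0) ?_ ?_ ?_ ?_ ?_).symm
  · intro K hK
    rw [mem_partialArrays hTL] at hK ⊢
    rw [isPartialArray_update_iff hg hT hTL hi hn' K (hK.eq_zero i n (by rw [hi]; omega))]
    exact hK
  · intro K hK
    rw [mem_partialArrays hTL] at hK ⊢
    rw [← isPartialArray_update_iff hg hT hTL hi hn' _ (by simp), Function.update_idem]
    have : K (i, n) = a := entry_eq_of_grow hg hi hn' hK
    convert hK using 1
    exact Function.update_eq_self_iff.2 this.symm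
  · intro K hK
    rw [mem_partialArrays hTL] at hK
    simp only [Function.update_idem]
    exact Function.update_eq_self_iff.2 (hK.eq_zero i n (by rw [hi]; omega)).symm
  · intro K hK
    rw [mem_partialArrays hTL] at hK
    simp only [Function.update_idem]
    exact Function.update_eq_self_iff.2 (entry_eq_of_grow hg hi hn' hK).symm
  · intro K hK
    have : ∀ p : Fin d × Fin N,
        (if (p.2.val : ℤ) < Function.update M a (M a + 1) (T p.1) + p.1.val then
          stayWt z (Function.update K (i, n) a p) (p.2.val - p.1.val) else 1) =
        (if p = (i, n) then stayWt z a (M a) else 1) *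
        (if (p.2.val : ℤ) < M (T p.1) + p.1.val then
          stayWt z (K p) (p.2.val - p.1.val) else 1) := by
      rintro ⟨j, s⟩
      by_cases hp : (j, s) = (i, n)
      · rw [if_pos hp]
        obtain ⟨rfl, rfl⟩ := Prod.mk.inj hp
        simp only [Function.update_self, hi]
        rw [if_pos (by omega), if_neg (by omega), mul_one]
        congr 1; omega
      · rw [if_neg hp, one_mul, Function.update_of_ne hp]
        by_cases hj : j = i
        · subst hj
          have : s.val ≠ n.val := fun h => hp (by rw [Fin.ext h])
          simp only [hi, Function.update_self]
          congr 1
          apply propext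
          constructor <;> intro <;> omega
        · have : T j ≠ a := fun h => hj (hT.injective (h.trans hi.symm))
          simp only [Function.update_of_ne this]
    unfold arrayWt
    simp only [this]
    rw [Finset.prod_mul_distrib]
    simp

theorem pendingWt_grow_self {z : ℕ → ℤ → ℂ} (hz0 : ∀ h, z 0 h = 1) {M : ℕ → ℤ} {a : ℕ}
    (hprev : ∀ b, b + 1 = a → M b = M a + 1) :
    pendingWt z (Function.update M a (M a + 1)) a = pendingWt z M a * (z a (M a + 1))⁻¹ := by
  cases a with
  | zero => simp [pendingWt, hz0]
  | succ b =>
    have := hprev b rfl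
    simp [pendingWt, this]

theorem prod_pendingWt_grow_of_notMem {d : ℕ} {z : ℕ → ℤ → ℂ} (hz0 : ∀ h, z 0 h = 1)
    {M : ℕ → ℤ} {a : ℕ} (hprev : ∀ b, b + 1 = a → M b = M a + 1)
    {T : Fin d → ℕ} (hT : StrictMono T) {i : Fin d} (hi : T i = a) (h' : ∀ j, T j ≠ a + 1) :
    ∏ j, pendingWt z (Function.update M a (M a + 1)) (T j) =
      (∏ j, pendingWt z M (T j)) * (z a (M a + 1))⁻¹ := by
  have : ∀ j, pendingWt z (Function.update M a (M a + 1)) (T j) =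
      pendingWt z M (T j) * (if j = i then (z a (M a + 1))⁻¹ else 1) := by
    intro j
    by_cases hj : j = i
    · rw [if_pos hj, hj, hi, pendingWt_grow_self hz0 hprev]
    · have h1 : T j ≠ a := fun h => hj (hT.injective (h.trans hi.symm))
      have h2 := h' j
      rw [if_neg hj, mul_one]
      refine pendingWt_congr (Function.update_of_ne h1 _ _) fun b hb => ?_
      rw [Function.update_of_ne (by omega), Function.update_of_ne (by omega)]
  rw [Finset.prod_congr rfl fun j _ => this j, Finset.prod_mul_distrib]
  simp

theorem prod_pendingWt_grow_of_mem {d : ℕ} {z : ℕ → ℤ → ℂ} (hz0 : ∀ h, z 0 h = 1)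
    (hz : ∀ b h, z b h ≠ 0) {M : ℕ → ℤ} {a : ℕ} (hnext : M a = M (a + 1))
    (hprev : ∀ b, b + 1 = a → M b = M a + 1)
    {T : Fin d → ℕ} (hT : StrictMono T) {i k : Fin d} (hi : T i = a) (hk : T k = a + 1) :
    ∏ j, pendingWt z (Function.update M a (M a + 1)) (T j) =
      (∏ j, pendingWt z M (T j)) * (z a (M a + 1))⁻¹ * z (a + 1) (M a) := by
  have : ∀ j, pendingWt z (Function.update M a (M a + 1)) (T j) =
      pendingWt z M (T j) * (if j = i then (z a (M a + 1))⁻¹ else 1) *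
        (if j = k then z (a + 1) (M a) else 1) := by
    intro j
    by_cases hj : j = i
    · have : i ≠ k := by rintro rfl; omega
      rw [hj, if_pos rfl, hi, if_neg this, mul_one, pendingWt_grow_self hz0 hprev]
    · have h1 : T j ≠ a := fun h => hj (hT.injective (h.trans hi.symm))
      rw [if_neg hj, mul_one]
      by_cases hjk : j = k
      · have := hz (a + 1) (M (a + 1))
        rw [hjk, hk, if_pos rfl]
        simp [pendingWt, hnext, this]
      · have h2 : T j ≠ a + 1 := fun h => hjk (hT.injective (h.trans hk.symm))
        rw [if_neg hjk, mul_one]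
        refine pendingWt_congr (Function.update_of_ne h1 _ _) fun b hb => ?_
        rw [Function.update_of_ne (by omega), Function.update_of_ne (by omega)]
  rw [Finset.prod_congr rfl fun j _ => this j, Finset.prod_mul_distrib, Finset.prod_mul_distrib]
  simp

theorem arraySum_grow_of_mem_of_notMem {d L N : ℕ} {z : ℕ → ℤ → ℂ} (hz0 : ∀ h, z 0 h = 1)
    (hz : ∀ b h, z b h ≠ 0) {M : ℕ → ℤ} {a : ℕ} (hg : CanGrow L d N M a)
    {T : Fin d → ℕ} (hT : StrictMono T) (hTL : ∀ i, T i < L)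
    {i : Fin d} (hi : T i = a) (h' : ∀ j, T j ≠ a + 1) :
    arraySum L N z (Function.update M a (M a + 1)) T =
      (z (a + 1) (M a))⁻¹ * arraySum L N z M T := by
  have h1 := hz a (M a + 1)
  have h2 := hz (a + 1) (M a)
  unfold arraySum
  rw [prod_pendingWt_grow_of_notMem hz0 hg.prev hT hi h', sum_arrayWt_grow hg hT hTL hi, stayWt]
  field_simp

theorem arraySum_grow_of_mem_of_mem {d L N : ℕ} {z : ℕ → ℤ → ℂ} (hz0 : ∀ h, z 0 h = 1)
    (hz : ∀ b h, z b h ≠ 0) {M : ℕ → ℤ} {a : ℕ} (hg : CanGrow L d N M a)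
    {T : Fin d → ℕ} (hT : StrictMono T) (hTL : ∀ i, T i < L)
    {i k : Fin d} (hi : T i = a) (hk : T k = a + 1) :
    arraySum L N z (Function.update M a (M a + 1)) T = arraySum L N z M T := by
  have h1 := hz a (M a + 1)
  have h2 := hz (a + 1) (M a)
  unfold arraySum
  rw [prod_pendingWt_grow_of_mem hz0 hz (hg.next (hk ▸ hTL k)) hg.prev hT hi hk,
    sum_arrayWt_grow hg hT hTL hi, stayWt]
  field_simp

theorem strictMono_update {d : ℕ} {T : Fin d → ℕ} (hT : StrictMono T) {i : Fin d} {c : ℕ}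
    (hlt : ∀ j, j < i → T j < c) (hgt : ∀ j, i < j → c < T j) :
    StrictMono (Function.update T i c) := by
  intro j k hjk
  by_cases hj : j = i
  · subst hj
    rw [Function.update_self, Function.update_of_ne hjk.ne']
    exact hgt k hjk
  · by_cases hk : k = i
    · subst hk
      rw [Function.update_self, Function.update_of_ne hj]
      exact hlt j hjk
    · rw [Function.update_of_ne hj, Function.update_of_ne hk]
      exact hT hjk

/-- A particle found at `a + 1` after an operation at `a` either waited at `a + 1`, or came from
`a`; the record is the same before and after. -/
theorem isPartialArray_grow_iff {d L N : ℕ} {M : ℕ → ℤ} {a : ℕ} (hg : CanGrow L d N M a)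
    {T : Fin d → ℕ} (hT : StrictMono T) (hTL : ∀ i, T i < L) {i : Fin d} (hi : T i = a + 1)
    (h' : ∀ j, T j ≠ a) (K : Fin d × Fin N → ℕ) :
    IsPartialArray (Function.update M a (M a + 1)) T K ↔
      IsPartialArray M T K ∨ IsPartialArray M (Function.update T i a) K := by
  have hnext : M a = M (a + 1) := hg.next (hi ▸ hTL i)
  have hM : ∀ j, Function.update M a (M a + 1) (T j) = M (T j) := fun j =>
    Function.update_of_ne (h' j) _ _
  have hM' : ∀ j, M (Function.update T i a j) = M (T j) := by
    intro j
    by_cases hj : j = i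
    · rw [hj, Function.update_self, hi, hnext]
    · rw [Function.update_of_ne hj]
  have hlast : ∀ j b, j ≠ i → T j = b + 1 →
      (Function.update M a (M a + 1) b = Function.update M a (M a + 1) (b + 1) ↔
        M b = M (b + 1)) := by
    intro j b hj hb
    have h1 := hM j
    rw [hb] at h1
    have : T j ≠ a + 1 := fun h => hj (hT.injective (h.trans hi.symm))
    rw [h1, Function.update_of_ne (by omega)]
  constructor
  · rintro ⟨h1, h2, h3, h4, h5, h6⟩
    simp only [hM] at h1 h2 h3 h4 h5 h6
    by_cases hl : ∃ s : Fin N, (s.val : ℤ) + 1 = M (T i) + i.val ∧ K (i, s) = T i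
    · refine Or.inl ⟨h1, h2, h3, h4, h5, fun j b hb hMb => ?_⟩
      by_cases hj : j = i
      · rw [hj]; exact hl
      · exact h6 j b hb ((hlast j b hj hb).2 hMb)
    · refine Or.inr ⟨?_, ?_, ?_, ?_, ?_, ?_⟩
      · simpa only [hM'] using h1
      · simp only [hM']
        intro j s hs
        by_cases hj : j = i
        · subst hj
          rw [Function.update_self]
          have hb := hg.bound
          have hjd := j.isLt
          have hj0 : M (T j) = M a := by rw [hi, hnext]
          let t : Fin N := ⟨(M a + j.val - 1).toNat, by omega⟩
          have ht : (t.val : ℤ) + 1 = M (T j) + j.val := by simp only [t]; omega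
          have e1 := h4 j s t (by rw [Fin.le_def]; omega) (by omega)
          have e2 := h2 j t (by omega)
          have e3 : K (j, t) ≠ T j := fun h => hl ⟨t, ht, h⟩
          omega
        · rw [Function.update_of_ne hj]; exact h2 j s hs
      · simpa only [hM'] using h3
      · simpa only [hM'] using h4
      · simpa only [hM'] using h5
      · simp only [hM']
        intro j b hb hMb
        by_cases hj : j = i
        · subst hj
          rw [Function.update_self] at hb
          have := hg.prev b hb.symm
          rw [← hb] at hMb
          omega
        · rw [Function.update_of_ne hj] at hb ⊢
          exact h6 j b hb ((hlast j b hj hb).2 hMb)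
  · rintro (⟨h1, h2, h3, h4, h5, h6⟩ | ⟨h1, h2, h3, h4, h5, h6⟩)
    · simp only [← hM] at h1 h2 h3 h4 h5 h6
      refine ⟨h1, h2, h3, h4, h5, fun j b hb hMb => ?_⟩
      by_cases hj : j = i
      · subst hj
        have : b = a := by omega
        subst this
        rw [Function.update_self, Function.update_of_ne (by omega)] at hMb
        omega
      · exact h6 j b hb ((hlast j b hj hb).1 hMb)
    · simp only [hM'] at h1 h2 h3 h4 h5 h6
      simp only [← hM] at h1 h2 h3 h4 h5 h6
      refine ⟨h1, fun j s hs => (h2 j s hs).trans ?_, h3, h4, h5, fun j b hb hMb => ?_⟩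
      · by_cases hj : j = i
        · rw [hj, Function.update_self, hi]; omega
        · rw [Function.update_of_ne hj]
      · by_cases hj : j = i
        · subst hj
          have : b = a := by omega
          subst this
          rw [Function.update_self, Function.update_of_ne (by omega)] at hMb
          omega
        · have := h6 j b (by rw [Function.update_of_ne hj, hb]) ((hlast j b hj hb).1 hMb)
          rwa [Function.update_of_ne hj] at this

theorem arraySum_grow_of_mem_succ {d L N : ℕ} {z : ℕ → ℤ → ℂ}
    (hz : ∀ b h, z b h ≠ 0) {M : ℕ → ℤ} {a : ℕ} (hg : CanGrow L d N M a)
    {T : Fin d → ℕ} (hT : StrictMono T) (hTL : ∀ i, T i < L) {i : Fin d} (hi : T i = a + 1)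
    (h' : ∀ j, T j ≠ a) :
    arraySum L N z (Function.update M a (M a + 1)) T =
      z (a + 1) (M a) * arraySum L N z M T + arraySum L N z M (Function.update T i a) := by
  classical
  have hnext : M a = M (a + 1) := hg.next (hi ▸ hTL i)
  have hTL' : ∀ j, Function.update T i a j < L := by
    intro j
    by_cases hj : j = i
    · rw [hj, Function.update_self]; exact hg.lt
    · rw [Function.update_of_ne hj]; exact hTL j
  have hM : ∀ j, Function.update M a (M a + 1) (T j) = M (T j) := fun j =>
    Function.update_of_ne (h' j) _ _
  have hM' : ∀ j, M (Function.update T i a j) = M (T j) := by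
    intro j
    by_cases hj : j = i
    · rw [hj, Function.update_self, hi, hnext]
    · rw [Function.update_of_ne hj]
  have hunion : partialArrays L N (Function.update M a (M a + 1)) T =
      partialArrays L N M T ∪ partialArrays L N M (Function.update T i a) := by
    ext K
    rw [Finset.mem_union, mem_partialArrays hTL, mem_partialArrays hTL, mem_partialArrays hTL',
      isPartialArray_grow_iff hg hT hTL hi h']
  have hdisj : Disjoint (partialArrays L N M T)
      (partialArrays L N M (Function.update T i a)) := by
    rw [Finset.disjoint_left]
    intro K hK hK'
    rw [mem_partialArrays hTL] at hK
    rw [mem_partialArrays hTL'] at hK'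
    obtain ⟨s, hs, hs'⟩ := hK.last i a hi hnext
    have := hK'.le_pos i s (by rw [hM']; omega)
    rw [Function.update_self] at this
    omega
  have hwt : ∀ K : Fin d × Fin N → ℕ, arrayWt z (Function.update M a (M a + 1)) T K =
      arrayWt z M T K := by
    intro K; simp only [arrayWt, hM]
  have hwt' : ∀ K : Fin d × Fin N → ℕ, arrayWt z M (Function.update T i a) K =
      arrayWt z M T K := by
    intro K; simp only [arrayWt, hM']
  have hp : ∏ j, pendingWt z M (T j) =
      (∏ j, pendingWt z (Function.update M a (M a + 1)) (T j)) * (z (a + 1) (M a))⁻¹ := by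
    have : ∀ j, pendingWt z M (T j) =
        pendingWt z (Function.update M a (M a + 1)) (T j) *
          (if j = i then (z (a + 1) (M a))⁻¹ else 1) := by
      intro j
      by_cases hj : j = i
      · rw [if_pos hj, hj, hi]
        simp [pendingWt, hnext]
      · rw [if_neg hj, mul_one]
        refine (pendingWt_congr (hM j) fun b hb => ?_).symm
        have : T j ≠ a + 1 := fun h => hj (hT.injective (h.trans hi.symm))
        have := h' j
        rw [Function.update_of_ne (by omega), Function.update_of_ne (by omega)]
    rw [Finset.prod_congr rfl fun j _ => this j, Finset.prod_mul_distrib]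
    simp
  have hp' : ∏ j, pendingWt z M (Function.update T i a j) =
      ∏ j, pendingWt z (Function.update M a (M a + 1)) (T j) := by
    refine Finset.prod_congr rfl fun j _ => ?_
    by_cases hj : j = i
    · rw [hj, Function.update_self, hi]
      rcases Nat.eq_zero_or_pos a with h | h
      · subst h
        simp [pendingWt, hnext]
      · obtain ⟨b, rfl⟩ : ∃ b, a = b + 1 := ⟨a - 1, by omega⟩
        have := hg.prev b rfl
        have h1 : M b ≠ M (b + 1) := by omega
        have h2 : Function.update M (b + 1) (M (b + 1) + 1) (b + 1) ≠
            Function.update M (b + 1) (M (b + 1) + 1) (b + 1 + 1) := by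
          rw [Function.update_self, Function.update_of_ne (Nat.succ_ne_self _), ← hnext]
          exact (lt_add_one _).ne'
        simp only [pendingWt, h1, h2, if_false]
    · rw [Function.update_of_ne hj]
      refine (pendingWt_congr (hM j) fun b hb => ?_).symm
      have : T j ≠ a + 1 := fun h => hj (hT.injective (h.trans hi.symm))
      have := h' j
      rw [Function.update_of_ne (by omega), Function.update_of_ne (by omega)]
  have h2 := hz (a + 1) (M a)
  unfold arraySum
  rw [hunion, Finset.sum_union hdisj, hp, hp']
  simp only [hwt, hwt']
  field_simp

/-- The minor with rows `T` of the family `R` of rows of length `d`. -/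
def rowMinor {d : ℕ} (R : ℕ → Fin d → ℂ) (T : Fin d → ℕ) : ℂ :=
  (Matrix.of fun i => R (T i)).det

/-- The elementary operation at position `a` with parameter `y`: the action on rows of
`y_i(y) α_i^∨(y⁻¹)` for one pair of positions `a`, `a + 1`. -/
noncomputable def rowOp {d : ℕ} (a : ℕ) (y : ℂ) (R : ℕ → Fin d → ℂ) : ℕ → Fin d → ℂ := fun b =>
  if b = a then y⁻¹ • R a else if b = a + 1 then y • R (a + 1) + R a else R b

theorem rowMinor_rowOp_of_notMem {d : ℕ} (a : ℕ) (y : ℂ) (R : ℕ → Fin d → ℂ) {T : Fin d → ℕ}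
    (h1 : ∀ i, T i ≠ a) (h2 : ∀ i, T i ≠ a + 1) :
    rowMinor (rowOp a y R) T = rowMinor R T := by
  unfold rowMinor rowOp
  simp only [h1, h2, if_false]

theorem rowMinor_rowOp_of_mem_of_notMem {d : ℕ} (a : ℕ) (y : ℂ) (R : ℕ → Fin d → ℂ)
    {T : Fin d → ℕ} (hT : StrictMono T) {i : Fin d} (hi : T i = a) (h2 : ∀ i, T i ≠ a + 1) :
    rowMinor (rowOp a y R) T = y⁻¹ * rowMinor R T := by
  have : (Matrix.of fun j => rowOp a y R (T j)) =
      (Matrix.of fun j => R (T j)).updateRow i (y⁻¹ • R a) := by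
    ext j l
    by_cases hj : j = i
    · subst hj; simp [rowOp, hi]
    · have h1 : T j ≠ a := fun h => hj (hT.injective (h.trans hi.symm))
      simp [rowOp, Matrix.updateRow_ne hj, h1, h2 j]
  rw [rowMinor, this, Matrix.det_updateRow_smul, rowMinor, ← hi]
  congr 2
  exact Matrix.updateRow_eq_self _ i

theorem rowMinor_rowOp_of_mem_succ {d : ℕ} (a : ℕ) (y : ℂ) (R : ℕ → Fin d → ℂ)
    {T : Fin d → ℕ} (hT : StrictMono T) {i : Fin d} (hi : T i = a + 1) (h2 : ∀ i, T i ≠ a) :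
    rowMinor (rowOp a y R) T =
      y * rowMinor R T + rowMinor R (Function.update T i a) := by
  have h1 : ∀ j, j ≠ i → T j ≠ a + 1 := fun j hj h => hj (hT.injective (h.trans hi.symm))
  have : (Matrix.of fun j => rowOp a y R (T j)) =
      (Matrix.of fun j => R (T j)).updateRow i (y • R (a + 1) + R a) := by
    ext j l
    by_cases hj : j = i
    · subst hj; simp [rowOp, hi]
    · simp [rowOp, Matrix.updateRow_ne hj, h1 j hj, h2 j]
  rw [rowMinor, this, Matrix.det_updateRow_add, Matrix.det_updateRow_smul, rowMinor, rowMinor, ← hi]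
  congr 2
  · exact congrArg _ (congrArg _ (Matrix.updateRow_eq_self _ i))
  · ext j l
    by_cases hj : j = i
    · subst hj; simp
    · simp [Matrix.updateRow_ne hj, Function.update_of_ne hj]

theorem rowMinor_rowOp_of_mem_of_mem {d : ℕ} (a : ℕ) {y : ℂ} (hy : y ≠ 0) (R : ℕ → Fin d → ℂ)
    {T : Fin d → ℕ} (hT : StrictMono T) {i k : Fin d} (hi : T i = a) (hk : T k = a + 1) :
    rowMinor (rowOp a y R) T = rowMinor R T := by
  have hik : i ≠ k := by rintro rfl; omega
  obtain ⟨A, hA⟩ : ∃ A : Matrix (Fin d) (Fin d) ℂ, A = Matrix.of fun j => R (T j) := ⟨_, rfl⟩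
  have hAj : ∀ j, A j = R (T j) := by rw [hA]; exact fun _ => rfl
  have : (Matrix.of fun j => rowOp a y R (T j)) =
      (A.updateRow k (y • A k + A i)).updateRow i (y⁻¹ • A i) := by
    rw [hAj, hAj, hi, hk]
    ext j l
    by_cases hj : j = i
    · subst hj; simp [rowOp, hi]
    · have h1 : T j ≠ a := fun h => hj (hT.injective (h.trans hi.symm))
      rw [Matrix.updateRow_ne hj]
      by_cases hjk : j = k
      · subst hjk; simp [rowOp, hk]
      · have h3 : T j ≠ a + 1 := fun h => hjk (hT.injective (h.trans hk.symm))
        rw [Matrix.updateRow_ne hjk]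
        simp [rowOp, h1, h3, hAj]
  rw [rowMinor, this, Matrix.det_updateRow_smul]
  have e1 : (A.updateRow k (y • A k + A i)).updateRow i (A i) =
      A.updateRow k (y • A k + A i) := by
    conv_rhs => rw [← Matrix.updateRow_eq_self (A.updateRow k (y • A k + A i)) i]
    rw [Matrix.updateRow_ne hik]
  rw [e1, Matrix.det_updateRow_add, Matrix.det_updateRow_smul,
    Matrix.det_updateRow_eq_zero hik, Matrix.updateRow_eq_self, rowMinor, ← hA, add_zero,
    inv_mul_cancel_left₀ hy]

/-- The recursion: if the minors of `R` are the total weights of histories for the growth function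
`M`, then one operation at `a` makes them those for `M` with `M a` raised by one. -/
theorem rowMinor_rowOp_eq_arraySum {d L N : ℕ} {z : ℕ → ℤ → ℂ} (hz0 : ∀ h, z 0 h = 1)
    (hz : ∀ b h, z b h ≠ 0) {M : ℕ → ℤ} {a : ℕ} (hg : CanGrow L d N M a) {R : ℕ → Fin d → ℂ}
    (hR : ∀ T : Fin d → ℕ, StrictMono T → (∀ i, T i < L) → rowMinor R T = arraySum L N z M T)
    {T : Fin d → ℕ} (hT : StrictMono T) (hTL : ∀ i, T i < L) :
    rowMinor (rowOp a (z (a + 1) (M a)) R) T =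
      arraySum L N z (Function.update M a (M a + 1)) T := by
  by_cases h1 : ∃ i, T i = a
  · obtain ⟨i, hi⟩ := h1
    by_cases h2 : ∃ k, T k = a + 1
    · obtain ⟨k, hk⟩ := h2
      rw [rowMinor_rowOp_of_mem_of_mem a (hz _ _) R hT hi hk,
        arraySum_grow_of_mem_of_mem hz0 hz hg hT hTL hi hk, hR T hT hTL]
    · push Not at h2
      rw [rowMinor_rowOp_of_mem_of_notMem a _ R hT hi h2,
        arraySum_grow_of_mem_of_notMem hz0 hz hg hT hTL hi h2, hR T hT hTL]
  · push Not at h1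
    by_cases h2 : ∃ k, T k = a + 1
    · obtain ⟨k, hk⟩ := h2
      have hT' : StrictMono (Function.update T k a) := by
        refine strictMono_update hT (fun j hj => ?_) (fun j hj => ?_)
        · have := hT hj
          have := h1 j
          omega
        · have := hT hj
          omega
      have hTL' : ∀ j, Function.update T k a j < L := by
        intro j
        by_cases hj : j = k
        · rw [hj, Function.update_self]; exact hg.lt
        · rw [Function.update_of_ne hj]; exact hTL j
      rw [rowMinor_rowOp_of_mem_succ a _ R hT hk h1,
        arraySum_grow_of_mem_succ hz hg hT hTL hk h1, hR T hT hTL, hR _ hT' hTL']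
    · push Not at h2
      rw [rowMinor_rowOp_of_notMem a _ R h1 h2, arraySum_grow_of_notMem h1 h2, hR T hT hTL]

/-! ### The minors of `x^L_𝐢(𝐘)` with columns `1, …, d` -/

/-- The rows of `g`, restricted to the first `d` columns and extended by `0` to all of `ℕ`. -/
def rowsOf {d L : ℕ} (hd : d ≤ L) (g : Matrix (Fin L) (Fin L) ℂ) : ℕ → Fin d → ℂ := fun b j =>
  if h : b < L then g ⟨b, h⟩ (Fin.castLE hd j) else 0

theorem rowsOf_apply {d L : ℕ} (hd : d ≤ L) (g : Matrix (Fin L) (Fin L) ℂ) {b : ℕ} (hb : b < L)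
    (j : Fin d) : rowsOf hd g b j = g ⟨b, hb⟩ (Fin.castLE hd j) := dif_pos hb

theorem yNeg_val {r : ℕ} (i : Fin r) (t : ℂ) : (yNeg i t).val.val = 1 + t • fMat i :=
  exp_of_sq_zero _ (fMat_sq i) t

theorem xPos_val {r : ℕ} (i : Fin r) (t : ℂ) : (xPos i t).val.val = 1 + t • eMat i :=
  exp_of_sq_zero _ (eMat_sq i) t

theorem coroot_val {r : ℕ} (i : Fin r) (t : ℂˣ) :
    (coroot i t).val.val = Matrix.diagonal fun p => ((t ^ corootWt i p : ℂˣ) : ℂ) := rfl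

theorem rowsOf_add {d L : ℕ} (hd : d ≤ L) (g h : Matrix (Fin L) (Fin L) ℂ) (b : ℕ) :
    rowsOf hd (g + h) b = rowsOf hd g b + rowsOf hd h b := by
  ext j
  by_cases hb : b < L <;> simp [rowsOf, hb]

theorem rowsOf_smul {d L : ℕ} (hd : d ≤ L) (c : ℂ) (g : Matrix (Fin L) (Fin L) ℂ) (b : ℕ) :
    rowsOf hd (c • g) b = c • rowsOf hd g b := by
  ext j
  by_cases hb : b < L <;> simp [rowsOf, hb]

theorem rowsOf_single_mul {d L : ℕ} (hd : d ≤ L) (p q : Fin L) (g : Matrix (Fin L) (Fin L) ℂ)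
    (b : ℕ) : rowsOf hd (Matrix.single p q 1 * g) b = if b = p.val then rowsOf hd g q.val else 0 := by
  have hp := p.isLt
  ext j
  by_cases hb : b = p.val
  · subst hb; simp [rowsOf]
  · by_cases hbL : b < L
    · rw [if_neg hb, rowsOf_apply hd _ hbL]
      exact Matrix.single_mul_apply_of_ne _ _ _ _ _ (fun h => hb (by rw [← h])) _
    · simp [rowsOf, hb, hbL]

theorem rowsOf_fMat_mul {r d : ℕ} (hd : d ≤ 2 * r) (i : Fin r)
    (g : Matrix (Fin (2 * r)) (Fin (2 * r)) ℂ) (b : ℕ) :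
    rowsOf hd (fMat i * g) b = (if b = i.val + 1 then rowsOf hd g i.val else 0) +
      (if i.val + 1 < r ∧ b = 2 * r - 1 - i.val then rowsOf hd g (2 * r - 2 - i.val) else 0) := by
  have hi := i.isLt
  have e : 2 * r - 2 - i.val = 2 * r - 1 - (i.val + 1) := by omega
  unfold fMat
  split_ifs with h h1 h2 h2 h1 <;>
    simp only [Matrix.add_mul, rowsOf_add, rowsOf_single_mul, un, bar, e]
  all_goals try rw [if_pos (by omega)]
  all_goals try rw [if_neg (by omega)]
  all_goals try rw [if_pos (by omega)]
  all_goals try simp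
  all_goals omega

theorem rowsOf_diagonal_mul {d L : ℕ} (hd : d ≤ L) (f : Fin L → ℂ) (F : ℕ → ℂ)
    (hF : ∀ p : Fin L, f p = F p.val) (g : Matrix (Fin L) (Fin L) ℂ) (b : ℕ) :
    rowsOf hd (Matrix.diagonal f * g) b = F b • rowsOf hd g b := by
  ext j
  by_cases hb : b < L <;> simp [rowsOf, hb, hF]

theorem rowsOf_xNeg_mul {r d : ℕ} (hd : d ≤ 2 * r) (i : Fin r) (t : ℂˣ)
    (g : Matrix (Fin (2 * r)) (Fin (2 * r)) ℂ) :
    rowsOf hd ((xNeg i t).val.val * g) =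
      if i.val + 1 < r then rowOp i.val t (rowOp (2 * r - 2 - i.val) t (rowsOf hd g))
      else rowOp i.val t (rowsOf hd g) := by
  have hi := i.isLt
  have ht : (t : ℂ) ≠ 0 := t.ne_zero
  have e1 : (xNeg i t).val.val = (1 + (t : ℂ) • fMat i) *
      (Matrix.diagonal fun p => ((t⁻¹ ^ corootWt i p : ℂˣ) : ℂ)) := by
    rw [← yNeg_val, ← coroot_val]; rfl
  obtain ⟨F, hFd⟩ : ∃ F : ℕ → ℂ, F = fun b =>
      if b = i.val ∨ (i.val + 1 < r ∧ b = 2 * r - 2 - i.val) then (t : ℂ)⁻¹ else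
        if b = i.val + 1 ∨ (i.val + 1 < r ∧ b = 2 * r - 1 - i.val) then (t : ℂ) else 1 :=
    ⟨_, rfl⟩
  have hF : ∀ p : Fin (2 * r), ((t⁻¹ ^ corootWt i p : ℂˣ) : ℂ) = F p.val := by
    intro p
    have hp := p.isLt
    have : corootWt i p = if p.val = i.val ∨ (i.val + 1 < r ∧ p.val = 2 * r - 2 - i.val) then 1
        else if p.val = i.val + 1 ∨ (i.val + 1 < r ∧ p.val = 2 * r - 1 - i.val) then -1 else 0 := by
      unfold corootWt
      split_ifs <;> omega
    rw [this, hFd]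
    beta_reduce
    split_ifs <;> simp
  funext b
  rw [e1, Matrix.mul_assoc, Matrix.add_mul, Matrix.one_mul, Matrix.smul_mul, rowsOf_add,
    rowsOf_smul, rowsOf_fMat_mul, rowsOf_diagonal_mul hd _ F hF, rowsOf_diagonal_mul hd _ F hF,
    rowsOf_diagonal_mul hd _ F hF, hFd]
  by_cases h : i.val + 1 < r
  · simp only [h, true_and, if_true, rowOp]
    have f1 : ¬ (i.val = 2 * r - 2 - i.val) := by omega
    have f2 : ¬ (i.val = 2 * r - 2 - i.val + 1) := by omega
    have f4 : 2 * r - 2 - i.val + 1 = 2 * r - 1 - i.val := by omega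
    by_cases b1 : b = i.val
    · subst b1
      have f5 : ¬ (i.val = 2 * r - 1 - i.val) := by omega
      simp [f1, f2, f5]
    · by_cases b2 : b = i.val + 1
      · subst b2
        have f5 : ¬ (i.val + 1 = 2 * r - 1 - i.val) := by omega
        by_cases f6 : i.val + 1 = 2 * r - 2 - i.val
        · omega
        · simp [f1, f2, f5, f6, ht]
      · by_cases b3 : b = 2 * r - 2 - i.val
        · have f5 : ¬ (b = 2 * r - 1 - i.val) := by omega
          simp [b1, b2, ← b3, f5]
        · by_cases b4 : b = 2 * r - 1 - i.val
          · have f5 : ¬ (2 * r - 2 - i.val = i.val) := by omega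
            simp [b1, b2, b3, f4, ← b4, ht]
          · simp [b1, b2, b3, b4, f4]
  · simp only [h, false_and, if_false, or_false, add_zero, rowOp]
    by_cases b1 : b = i.val
    · subst b1; simp
    · by_cases b2 : b = i.val + 1
      · subst b2; simp [ht]
      · simp [b1, b2]

theorem getElem_flatten_replicate {α : Type*} (l : List α) (k j : ℕ) (hl : 0 < l.length)
    (h : j < ((List.replicate k l).flatten).length) :
    ((List.replicate k l).flatten)[j] = l[j % l.length]'(Nat.mod_lt _ hl) := by
  induction k generalizing j with
  | zero => simp at h
  | succ k ih =>
    simp only [List.replicate_succ, List.flatten_cons] at h ⊢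
    rw [List.getElem_append]
    split_ifs with h1
    · congr 1; exact (Nat.mod_eq_of_lt h1).symm
    · rw [ih]
      congr 1
      exact (Nat.mod_eq_sub_mod (not_lt.1 h1)).symm

theorem length_cycWord {r m d : ℕ} (hdr : d ≤ r) :
    (cycWord r m d).length = (m - 1) * r + d := by
  simp [cycWord, hdr]

theorem getElem_cycWord {r m d : ℕ} (hd : 1 ≤ d) (hdr : d ≤ r) (j : ℕ)
    (h : j < (cycWord r m d).length) : ((cycWord r m d)[j]).val = j % r := by
  have h0 := h
  rw [length_cycWord hdr] at h0
  unfold cycWord at h ⊢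
  rw [List.getElem_append]
  split_ifs with h1
  · rw [getElem_flatten_replicate _ _ _ (by simp; omega)]
    simp
  · simp only [List.length_flatten, List.map_replicate, List.length_finRange, List.sum_replicate,
      smul_eq_mul, not_lt] at h1 ⊢
    rw [List.getElem_take, List.getElem_finRange]
    simp only [Fin.val_cast]
    obtain ⟨c, rfl⟩ := Nat.exists_eq_add_of_le h1
    rw [Nat.add_sub_cancel_left, Nat.add_comm, Nat.add_mul_mod_self_right, Nat.mod_eq_of_lt]
    omega

/-- The zero-based index of the letter whose operation moves `v_a` to `v_{a+1}`. For `a = 2 r - 1`,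
the last position, it is `-1`: a fictitious operation of weight `1` at the end of each cycle. -/
def letterAt (r a : ℕ) : ℤ := if a < r then a else 2 * (r : ℤ) - 2 - a

/-- The growth function after `τ` full cycles and the letters `≥ l` of the next one: the number of
operations already done at `a`, minus `min(a, r - 1)`. -/
def height (r τ l a : ℕ) : ℤ :=
  τ + (if (l : ℤ) ≤ letterAt r a then 1 else 0) - min a (r - 1)

theorem canGrow_bar {r τ l d m : ℕ} (hl : l + 1 < r) (hτ : τ < m) :
    CanGrow (2 * r) d (m + d) (height r τ (l + 1)) (2 * r - 2 - l) where
  lt := by omega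
  anti b c hbc hc := by simp only [height, letterAt]; split_ifs <;> omega
  next h := by simp only [height, letterAt]; split_ifs <;> omega
  prev b hb := by simp only [height, letterAt]; split_ifs <;> omega
  zero := by simp only [height, letterAt]; split_ifs <;> omega
  bound := by simp only [height, letterAt]; split_ifs <;> omega

theorem height_update_bar {r τ l : ℕ} (hl : l + 1 < r) (a : ℕ) :
    Function.update (height r τ (l + 1)) (2 * r - 2 - l)
      (height r τ (l + 1) (2 * r - 2 - l) + 1) a =
      if a = 2 * r - 2 - l then height r τ l a else height r τ (l + 1) a := by
  by_cases ha : a = 2 * r - 2 - l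
  · subst ha
    rw [if_pos rfl, Function.update_self]
    simp only [height, letterAt]; split_ifs <;> omega
  · rw [if_neg ha, Function.update_of_ne ha]

theorem canGrow_un {r τ l d m : ℕ} (hl : l + 1 < r) (hτ : τ < m) :
    CanGrow (2 * r) d (m + d) (Function.update (height r τ (l + 1)) (2 * r - 2 - l)
      (height r τ (l + 1) (2 * r - 2 - l) + 1)) l := by
  have hu := height_update_bar (τ := τ) hl
  generalize Function.update (height r τ (l + 1)) (2 * r - 2 - l)
    (height r τ (l + 1) (2 * r - 2 - l) + 1) = f at hu ⊢
  refine ⟨by omega, fun b c hbc hc => ?_, fun h => ?_, fun b hb => ?_, ?_, ?_⟩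
  all_goals
    simp only [hu, height, letterAt]
    split_ifs <;> omega

theorem height_update_un {r τ l : ℕ} (hl : l + 1 < r) :
    Function.update (Function.update (height r τ (l + 1)) (2 * r - 2 - l)
      (height r τ (l + 1) (2 * r - 2 - l) + 1)) l
      (Function.update (height r τ (l + 1)) (2 * r - 2 - l)
      (height r τ (l + 1) (2 * r - 2 - l) + 1) l + 1) = height r τ l := by
  funext a
  by_cases ha : a = l
  · subst ha
    rw [Function.update_self, height_update_bar hl, if_neg (by omega)]
    simp only [height, letterAt]; split_ifs <;> omega
  · rw [Function.update_of_ne ha, height_update_bar hl]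
    split_ifs with h
    · rfl
    · simp only [height, letterAt]; split_ifs <;> omega

theorem canGrow_mid {r τ d m : ℕ} (hr : 1 ≤ r) (hτ : τ < m) :
    CanGrow (2 * r) d (m + d) (height r τ r) (r - 1) where
  lt := by omega
  anti b c hbc hc := by simp only [height, letterAt]; split_ifs <;> omega
  next h := by simp only [height, letterAt]; split_ifs <;> omega
  prev b hb := by simp only [height, letterAt]; split_ifs <;> omega
  zero := by simp only [height, letterAt]; split_ifs <;> omega
  bound := by simp only [height, letterAt]; split_ifs <;> omega

theorem height_update_mid {r τ : ℕ} (hr : 1 ≤ r) :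
    Function.update (height r τ r) (r - 1) (height r τ r (r - 1) + 1) = height r τ (r - 1) := by
  funext a
  by_cases ha : a = r - 1
  · subst ha
    rw [Function.update_self]
    simp only [height, letterAt]; split_ifs <;> omega
  · rw [Function.update_of_ne ha]
    simp only [height, letterAt]; split_ifs <;> omega

theorem canGrow_end {r τ d m : ℕ} (hr : 1 ≤ r) (hτ : τ < m) :
    CanGrow (2 * r) d (m + d) (height r τ 0) (2 * r - 1) where
  lt := by omega
  anti b c hbc hc := by simp only [height, letterAt]; split_ifs <;> omega
  next h := by omega
  prev b hb := by simp only [height, letterAt]; split_ifs <;> omega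
  zero := by simp only [height, letterAt]; split_ifs <;> omega
  bound := by simp only [height, letterAt]; split_ifs <;> omega

theorem height_update_end {r τ : ℕ} (hr : 1 ≤ r) (a : ℕ) (ha : a < 2 * r) :
    Function.update (height r τ 0) (2 * r - 1) (height r τ 0 (2 * r - 1) + 1) a =
      height r (τ + 1) r a := by
  by_cases h : a = 2 * r - 1
  · subst h
    rw [Function.update_self]
    simp only [height, letterAt]; split_ifs <;> omega
  · rw [Function.update_of_ne h]
    simp only [height, letterAt]; split_ifs <;> omega

/-- `coordWt m w Y (a + 1) h` is the coordinate `Y_{s,l}` of the operation at position `a` that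
raises the growth function from `h` to `h + 1`; it is `1` for `a + 1 = 0`. -/
noncomputable def coordWt {r : ℕ} (m : ℕ) (w : List (Fin r)) (Y : Fin w.length → ℂˣ)
    (b : ℕ) (h : ℤ) : ℂ :=
  if b ≤ r then Yc w Y (m - h - b + 1) b else Yc w Y (m - h - r + 1) (2 * r - b)

theorem Yc_ne_zero {r : ℕ} (w : List (Fin r)) (Y : Fin w.length → ℂˣ) (s l : ℤ) :
    Yc w Y s l ≠ 0 := by
  unfold Yc
  split_ifs
  · exact Units.ne_zero _
  · exact one_ne_zero

theorem Yc_eq_one {r : ℕ} (w : List (Fin r)) (Y : Fin w.length → ℂˣ) (s l : ℤ)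
    (h : s ≤ 0 ∨ l ≤ 0 ) : Yc w Y s l = 1 := by
  unfold Yc
  rw [dif_neg (by omega)]

theorem coordWt_ne_zero {r : ℕ} (m : ℕ) (w : List (Fin r)) (Y : Fin w.length → ℂˣ)
    (b : ℕ) (h : ℤ) : coordWt m w Y b h ≠ 0 := by
  unfold coordWt
  split_ifs <;> exact Yc_ne_zero _ _ _ _

theorem coordWt_zero {r : ℕ} (m : ℕ) (w : List (Fin r)) (Y : Fin w.length → ℂˣ)
    (h : ℤ) : coordWt m w Y 0 h = 1 := by
  unfold coordWt
  rw [if_pos (Nat.zero_le _), Yc_eq_one _ _ _ _ (Or.inr (by simp))]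

theorem Yc_of_lt {r : ℕ} (w : List (Fin r)) (Y : Fin w.length → ℂˣ) (q l : ℕ) (hl : l < r)
    (h : q * r + l < w.length) {s k : ℤ} (hs : s = q + 1) (hk : k = l + 1) :
    Yc w Y s k = Y ⟨q * r + l, h⟩ := by
  subst hs hk
  have e : ((q : ℤ) + 1 - 1) * r + ((l : ℤ) + 1 - 1) = ((q * r + l : ℕ) : ℤ) := by
    push_cast; ring
  unfold Yc
  rw [dif_pos ⟨by omega, by omega, by omega, by rw [e]; exact_mod_cast h⟩]
  congr 3
  simp only [e, Int.toNat_natCast]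

theorem add_le_of_strictMono {d : ℕ} {T : Fin d → ℕ} (hT : StrictMono T) (i j : Fin d)
    (hij : i ≤ j) : T i + (j.val - i.val) ≤ T j := by
  obtain ⟨j, hj⟩ := j
  induction j with
  | zero =>
    have : i = ⟨0, hj⟩ := le_antisymm hij (Fin.mk_le_mk.2 (Nat.zero_le _))
    subst this; simp
  | succ j ih =>
    by_cases h : i.val = j + 1
    · have : i = ⟨j + 1, hj⟩ := Fin.ext h
      subst this; simp
    · have h1 : i.val ≤ j + 1 := hij
      have h2 := ih (by omega) (by rw [Fin.le_def]; simp only; omega)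
      have h3 : T ⟨j, by omega⟩ < T ⟨j + 1, hj⟩ := hT (by simp [Fin.lt_def])
      simp only at h2 ⊢
      omega

/-- At the start only the positions `0, …, d - 1` have a history, the empty one. The first letters of
the word, read from the right, are `d, …, 1`, so the zero-based
letters `≥ d` count as already applied. -/
theorem rowMinor_rowsOf_one {r d : ℕ} (hd : 1 ≤ d) (hdr : d ≤ r) (N : ℕ) {z : ℕ → ℤ → ℂ}
    {T : Fin d → ℕ} (hT : StrictMono T) (hTL : ∀ i, T i < 2 * r) :
    rowMinor (rowsOf (by omega : d ≤ 2 * r) 1) T =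
      arraySum (2 * r) N z (height r 0 d) T := by
  by_cases h : T ⟨d - 1, by omega⟩ < d
  · have hTi : ∀ i : Fin d, T i = i.val := by
      intro i
      have h1 := add_le_of_strictMono hT ⟨0, by omega⟩ i (Fin.mk_le_mk.2 (Nat.zero_le _))
      have h2 := add_le_of_strictMono hT i ⟨d - 1, by omega⟩
        (by rw [Fin.le_def]; simp only; omega)
      simp only at h1 h2
      omega
    have e1 : rowMinor (rowsOf (by omega : d ≤ 2 * r) 1) T = 1 := by
      unfold rowMinor
      have : (Matrix.of fun i => rowsOf (by omega : d ≤ 2 * r) 1 (T i)) =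
          (1 : Matrix (Fin d) (Fin d) ℂ) := by
        ext i j
        rw [Matrix.of_apply, rowsOf_apply _ _ (hTL i), Matrix.one_apply, Matrix.one_apply]
        congr 1
        simp [Fin.ext_iff, hTi]
      rw [this, Matrix.det_one]
    have hh : ∀ i : Fin d, height r 0 d (T i) + i.val = 0 := by
      intro i
      have := i.isLt
      rw [hTi]
      simp only [height, letterAt]; split_ifs <;> omega
    have hne : ∀ i b, T i = b + 1 → height r 0 d b ≠ height r 0 d (b + 1) := by
      intro i b hb
      have := i.isLt
      rw [hTi] at hb
      simp only [height, letterAt]; split_ifs <;> omega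
    have e2 : partialArrays (2 * r) N (height r 0 d) T = {0} := by
      ext K
      rw [mem_partialArrays hTL, Finset.mem_singleton]
      constructor
      · intro hK
        funext p
        exact hK.eq_zero p.1 p.2 (by rw [hh]; omega)
      · rintro rfl
        refine ⟨fun i => (hh i).ge, fun i s hs => ?_, fun i s hs => rfl, fun i s t _ hs => ?_,
          fun i j _ s hs => ?_, fun i b hb hM => (hne i b hb hM).elim⟩
        all_goals
          have := hh i
          omega
    have e3 : arrayWt z (height r 0 d) T (0 : Fin d × Fin N → ℕ) = 1 := by
      refine Finset.prod_eq_one fun p _ => if_neg ?_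
      have := hh p.1
      omega
    have e4 : ∏ i, pendingWt z (height r 0 d) (T i) = 1 := by
      refine Finset.prod_eq_one fun i _ => ?_
      rcases h0 : T i with _ | b
      · rfl
      · simp only [pendingWt, if_neg (hne i b h0)]
    rw [e1, arraySum, e2, Finset.sum_singleton, e3, e4, one_mul]
  · have e1 : rowMinor (rowsOf (by omega : d ≤ 2 * r) 1) T = 0 := by
      refine Matrix.det_eq_zero_of_row_eq_zero ⟨d - 1, by omega⟩ fun j => ?_
      rw [Matrix.of_apply, rowsOf_apply _ _ (hTL _), Matrix.one_apply_ne]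
      rw [Ne, Fin.ext_iff]
      have := j.isLt
      simp only [Fin.val_castLE]
      omega
    have e2 : partialArrays (2 * r) N (height r 0 d) T = ∅ := by
      rw [Finset.eq_empty_iff_forall_notMem]
      intro K hK
      rw [mem_partialArrays hTL] at hK
      have h1 := hK.count_nonneg ⟨d - 1, by omega⟩
      have h2 := hK.last ⟨d - 1, by omega⟩ (T ⟨d - 1, by omega⟩ - 1) (by omega)
      have h3 := hTL ⟨d - 1, by omega⟩
      generalize T ⟨d - 1, by omega⟩ = a at h h1 h2 h3
      simp only at h1 h2
      rw [show a - 1 + 1 = a by omega] at h2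
      have h4 : height r 0 d (a - 1) = height r 0 d a := by
        revert h1
        simp only [height, letterAt]; split_ifs <;> omega
      obtain ⟨s, hs, -⟩ := h2 h4
      revert hs
      simp only [height, letterAt]; split_ifs <;> omega
    rw [e1, arraySum, e2, Finset.sum_empty, mul_zero]

theorem coordWt_bar {r m : ℕ} (w : List (Fin r)) (Y : Fin w.length → ℂˣ) {q τ l : ℕ}
    (hq : q + τ + 1 = m) (hl : l + 1 < r) (h : q * r + l < w.length) :
    coordWt m w Y (2 * r - 2 - l + 1) (height r τ (l + 1) (2 * r - 2 - l)) =
      Y ⟨q * r + l, h⟩ := by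
  have : height r τ (l + 1) (2 * r - 2 - l) = τ - (r - 1) := by
    simp only [height, letterAt]; split_ifs <;> omega
  rw [coordWt, if_neg (by omega), this]
  exact Yc_of_lt w Y q l (by omega) h (by omega) (by omega)

theorem coordWt_un {r m : ℕ} (w : List (Fin r)) (Y : Fin w.length → ℂˣ) {q τ l : ℕ}
    (hq : q + τ + 1 = m) (hl : l < r) (h : q * r + l < w.length) {H : ℤ} (hH : H = τ - l) :
    coordWt m w Y (l + 1) H = Y ⟨q * r + l, h⟩ := by
  rw [coordWt, if_pos (by omega), hH]
  exact Yc_of_lt w Y q l (by omega) h (by omega) (by omega)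

theorem rowMinor_xNeg_mul {r m d : ℕ} (hd : d ≤ 2 * r) (w : List (Fin r))
    (Y : Fin w.length → ℂˣ) {q τ l : ℕ} (hq : q + τ + 1 = m) (hl : l < r)
    (h : q * r + l < w.length) (g : Matrix (Fin (2 * r)) (Fin (2 * r)) ℂ)
    (hg : ∀ T : Fin d → ℕ, StrictMono T → (∀ i, T i < 2 * r) →
      rowMinor (rowsOf hd g) T =
        arraySum (2 * r) (m + d) (coordWt m w Y) (height r τ (l + 1)) T)
    {T : Fin d → ℕ} (hT : StrictMono T) (hTL : ∀ i, T i < 2 * r) :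
    rowMinor (rowsOf hd ((xNeg ⟨l, hl⟩ (Y ⟨q * r + l, h⟩)).val.val * g)) T =
      arraySum (2 * r) (m + d) (coordWt m w Y) (height r τ l) T := by
  have hz0 := coordWt_zero m w Y
  have hz := coordWt_ne_zero m w Y
  rw [rowsOf_xNeg_mul]
  simp only
  split_ifs with h1
  · have c1 := canGrow_bar (d := d) h1 (by omega : τ < m)
    have c2 := canGrow_un (d := d) h1 (by omega : τ < m)
    have := rowMinor_rowOp_eq_arraySum hz0 hz c2
      (fun T hT hTL => rowMinor_rowOp_eq_arraySum hz0 hz c1 hg hT hTL) hT hTL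
    rw [height_update_un h1, coordWt_bar w Y hq h1 h, coordWt_un w Y hq hl h] at this
    · exact this
    · rw [height_update_bar h1, if_neg (by omega)]
      simp only [height, letterAt]; split_ifs <;> omega
  · obtain rfl : l = r - 1 := by omega
    rw [show r - 1 + 1 = r by omega] at hg
    have c1 := canGrow_mid (d := d) (by omega : 1 ≤ r) (by omega : τ < m)
    have := rowMinor_rowOp_eq_arraySum hz0 hz c1 hg hT hTL
    rw [height_update_mid (by omega), coordWt_un w Y hq hl h] at this
    · exact this
    · simp only [height, letterAt]; split_ifs <;> omega

/-- The fictitious operation at the last position, of weight `1`, leads from one cycle to the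
next. -/
theorem arraySum_height_zero {r m d : ℕ} (hr : 1 ≤ r) (w : List (Fin r))
    (Y : Fin w.length → ℂˣ) {τ : ℕ} (hτ : τ < m) {R : ℕ → Fin d → ℂ}
    (hR : ∀ T : Fin d → ℕ, StrictMono T → (∀ i, T i < 2 * r) →
      rowMinor R T = arraySum (2 * r) (m + d) (coordWt m w Y) (height r τ 0) T)
    {T : Fin d → ℕ} (hT : StrictMono T) (hTL : ∀ i, T i < 2 * r) :
    rowMinor R T = arraySum (2 * r) (m + d) (coordWt m w Y) (height r (τ + 1) r) T := by
  have := rowMinor_rowOp_eq_arraySum (coordWt_zero m w Y) (coordWt_ne_zero m w Y)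
    (canGrow_end (d := d) hr hτ) hR hT hTL
  have e1 : coordWt m w Y (2 * r - 1 + 1) (height r τ 0 (2 * r - 1)) = 1 := by
    rw [coordWt, if_neg (by omega), Yc_eq_one _ _ _ _ (Or.inr (by omega))]
  have e2 : rowMinor (rowOp (2 * r - 1) 1 R) T = rowMinor R T := by
    unfold rowMinor
    congr 2
    funext i
    have := hTL i
    unfold rowOp
    split_ifs with h1 h2
    · rw [h1, inv_one, one_smul]
    · omega
    · rfl
  rw [e1, e2] at this
  rw [this]
  refine (arraySum_congr (fun i => ?_) fun i b hb => ?_).symm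
  · exact (height_update_end hr _ (hTL i)).symm
  · have := hTL i
    rw [height_update_end hr _ (by omega), height_update_end hr _ (by omega)]

/-- The minors of `x^L_𝐢(𝐘)` with columns `1, …, d`, for any rows `T`. -/
theorem rowMinor_xL {r m d : ℕ} (hm : 1 ≤ m) (hd : 1 ≤ d) (hdr : d ≤ r)
    (Y : Fin (cycWord r m d).length → ℂˣ)
    {T : Fin d → ℕ} (hT : StrictMono T) (hTL : ∀ i, T i < 2 * r) :
    rowMinor (rowsOf (by omega : d ≤ 2 * r) (xL (cycWord r m d) Y).val.val) T =
      arraySum (2 * r) (m + d) (coordWt m (cycWord r m d) Y) (height r m r) T := by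
  have hd' : d ≤ 2 * r := by omega
  have hlen := length_cycWord (r := r) (m := m) hdr
  obtain ⟨S, hS⟩ : ∃ S : ℕ → Sp r, S = fun j =>
    ((List.ofFn fun p => xNeg ((cycWord r m d).get p) (Y p)).drop j).prod := ⟨_, rfl⟩
  obtain ⟨P, hP⟩ : ∃ P : ℕ → ℕ → Prop, P = fun τ l => ∀ q, q + τ + 1 = m →
    ∀ T : Fin d → ℕ, StrictMono T → (∀ i, T i < 2 * r) →
      rowMinor (rowsOf hd' (S (q * r + l)).val.val) T =
      arraySum (2 * r) (m + d) (coordWt m (cycWord r m d) Y) (height r τ l) T := ⟨_, rfl⟩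
  have hstep : ∀ τ l, l < r → (τ = 0 → l < d) → P τ (l + 1) → P τ l := by
    intro τ l hl hτ h
    rw [hP] at h ⊢
    intro q hq T hT hTL
    have hlt : q * r + l < (cycWord r m d).length := by
      rw [hlen]
      rcases Nat.eq_zero_or_pos τ with h0 | h0
      · have := hτ h0
        rw [show q = m - 1 by omega]; omega
      · have : (q + 1) * r ≤ (m - 1) * r := Nat.mul_le_mul_right _ (by omega)
        rw [Nat.add_mul] at this; omega
    have hSj : S (q * r + l) = xNeg ⟨l, hl⟩ (Y ⟨q * r + l, hlt⟩) * S (q * r + (l + 1)) := by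
      rw [hS]
      beta_reduce
      rw [List.drop_eq_getElem_cons (by rw [List.length_ofFn]; exact hlt), List.prod_cons,
        List.getElem_ofFn, add_assoc]
      congr 2
      ext
      rw [List.get_eq_getElem, getElem_cycWord hd hdr, Nat.mul_add_mod_of_lt hl]
    rw [hSj]
    exact rowMinor_xNeg_mul hd' _ Y hq hl hlt _ (h q hq) hT hTL
  have hdesc : ∀ τ l, l ≤ r → (τ = 0 → l ≤ d) → P τ l → P τ 0 := by
    intro τ l
    induction l with
    | zero => exact fun _ _ h => h
    | succ l ih =>
      intro h1 h2 h3
      exact ih (by omega) (fun h => by have := h2 h; omega)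
        (hstep τ l (by omega) (fun h => by have := h2 h; omega) h3)
  have hmain : ∀ τ, τ < m → P τ 0 := by
    intro τ
    induction τ with
    | zero =>
      intro _
      refine hdesc 0 d hdr (fun _ => le_rfl) ?_
      rw [hP]
      intro q hq T hT hTL
      have : S (q * r + d) = 1 := by
        rw [hS]
        beta_reduce
        rw [List.drop_eq_nil_of_le, List.prod_nil]
        rw [List.length_ofFn, hlen, show q = m - 1 by omega]
      rw [this]
      exact rowMinor_rowsOf_one hd hdr _ hT hTL
    | succ τ ih =>
      intro h
      refine hdesc (τ + 1) r le_rfl (fun h => by omega) ?_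
      have := ih (by omega)
      rw [hP] at this ⊢
      intro q hq T hT hTL
      refine arraySum_height_zero (by omega) _ Y (by omega) (fun T hT hTL => ?_) hT hTL
      have := this (q + 1) (by omega) T hT hTL
      rw [Nat.add_mul, one_mul, add_zero] at this
      exact this
  have h0 := hmain (m - 1) (by omega)
  rw [hP] at h0
  have h1 := arraySum_height_zero (by omega) _ Y (by omega) (h0 0 (by omega)) hT hTL
  rw [show m - 1 + 1 = m by omega, zero_mul, zero_add] at h1
  rw [← h1, hS]
  rfl

/-! ### Arrays at the extremal rows -/

/-- The rows `u_{≤k} {1, …, d}` in increasing order, zero-based: `m' + i` as long as this is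
unbarred, the last positions otherwise. -/
def target (r m' d i : ℕ) : ℕ := if m' + i < r then m' + i else 2 * r - d + i

/-- The number of stays of the particle `i` on its way from `i` to `target r m' d i` in `m`
cycles. -/
def targetCount (r m m' i : ℕ) : ℕ := if m' + i < r then m - m' else m + 1 + i - r

theorem target_lt {r m' d i : ℕ} (hdr : d ≤ r) (hi : i < d) : target r m' d i < 2 * r := by
  unfold target; split_ifs <;> omega

theorem strictMono_target {r m' d : ℕ} (hdr : d ≤ r) :
    StrictMono fun i : Fin d => target r m' d i := by
  intro i j hij
  have : i.val < j.val := hij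
  simp only [target]
  split_ifs <;> omega

theorem height_target {r m m' d i : ℕ} (hm' : m' ≤ m) (hmr : m ≤ r) (hdr : d ≤ r) (hi : i < d) :
    height r m r (target r m' d i) + i = targetCount r m m' i ∧
      (targetCount r m m' i : ℤ) ≤ m + i := by
  unfold target targetCount height letterAt
  split_ifs <;> omega

theorem pendingWt_target {r m m' d i : ℕ} (hdr : d ≤ r) (hi : i < d)
    (w : List (Fin r)) (Y : Fin w.length → ℂˣ) :
    pendingWt (coordWt m w Y) (height r m r) (target r m' d i) = 1 := by
  have := target_lt (m' := m') hdr hi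
  rcases h : target r m' d i with _ | b
  · rfl
  · rw [h] at this
    simp only [pendingWt]
    split_ifs with h1
    · rw [inv_eq_one, coordWt]
      have : r ≤ b + 1 ∧ height r m r (b + 1) = m - r + 1 := by
        revert h1
        unfold height letterAt
        split_ifs <;> omega
      rw [this.2]
      split_ifs
      · exact Yc_eq_one _ _ _ _ (Or.inl (by omega))
      · exact Yc_eq_one _ _ _ _ (Or.inl (by omega))
    · rfl

theorem strictMono_of_lt_succ {d : ℕ} {T : Fin d → ℕ}
    (h : ∀ i j : Fin d, i.val + 1 = j.val → T i < T j) : StrictMono T := by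
  rintro i ⟨j, hj⟩ hij
  have hij' : i.val < j := hij
  induction j with
  | zero => omega
  | succ j ih =>
    have h1 := h ⟨j, by omega⟩ ⟨j + 1, hj⟩ rfl
    by_cases h2 : i.val = j
    · have : i = ⟨j, by omega⟩ := Fin.ext h2
      rw [this]; exact h1
    · exact (ih (by omega) (by rw [Fin.lt_def]; simp only; omega) (by omega)).trans h1

/-- The surplus entries are forced: the last entry of a column that ends barred is its end position,
and strictness carries this over to the next column, whose end position is one larger. -/
theorem IsPartialArray.eq_target {r m m' d N : ℕ} (hm' : m' ≤ m) (hmr : m ≤ r)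
    (hdr : d ≤ r) {K : Fin d × Fin N → ℕ}
    (hK : IsPartialArray (height r m r) (fun i : Fin d => target r m' d i) K)
    (i : Fin d) (s : Fin N) (h1 : m - m' ≤ s.val) (h2 : s.val < targetCount r m m' i) :
    K (i, s) = target r m' d i := by
  obtain ⟨i, hi⟩ := i
  induction i with
  | zero =>
    have hc := (height_target hm' hmr hdr hi).1
    obtain ⟨t, ht, ht'⟩ := hK.last ⟨0, hi⟩ (target r m' d 0 - 1)
      (by simp only [target, targetCount] at h2 ⊢; split_ifs at h2 ⊢ <;> omega)
      (by simp only [target, targetCount, height, letterAt] at h2 ⊢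
          split_ifs at h2 ⊢ <;> omega)
    simp only at ht ht' hc h2
    rw [← ht']
    congr 2
    refine Fin.ext ?_
    simp only [targetCount] at h2 hc
    split_ifs at h2 hc <;> omega
  | succ i ih =>
    have hc := (height_target hm' hmr hdr hi).1
    have hc0 := (height_target hm' hmr hdr (by omega : i < d)).1
    by_cases hs : s.val + 1 = targetCount r m m' (i + 1)
    · obtain ⟨t, ht, ht'⟩ := hK.last ⟨i + 1, hi⟩ (target r m' d (i + 1) - 1)
        (by simp only [target, targetCount] at h2 ⊢; split_ifs at h2 ⊢ <;> omega)
        (by simp only [target, targetCount, height, letterAt] at h2 ⊢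
            split_ifs at h2 ⊢ <;> omega)
      simp only at ht ht' hc h2
      rw [← ht']
      congr 2
      refine Fin.ext ?_
      omega
    · have h3 : s.val < targetCount r m m' i := by
        simp only [targetCount] at h2 hs ⊢
        split_ifs at h2 hs ⊢ <;> omega
      have e1 := ih (by omega) h3
      have e2 := hK.strict ⟨i, by omega⟩ ⟨i + 1, hi⟩ rfl s (by simp only; omega)
        (by simp only at h2 ⊢; omega)
      have e3 := hK.le_pos ⟨i + 1, hi⟩ s (by simp only at h2 ⊢; omega)
      have e4 : target r m' d i + 1 = target r m' d (i + 1) := by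
        simp only [targetCount] at h3
        unfold target
        split_ifs at h3 ⊢ <;> omega
      simp only at e1 e3 ⊢
      omega

/-- An array with `m - m'` rows, continued in column `i` by the forced entries
`target r m' d i` up to length `targetCount r m m' i`. -/
def extendArray {r m m' d N : ℕ} (K : Fin (m - m') → Fin d → Fin (2 * r)) :
    Fin d × Fin N → ℕ := fun p =>
  if h : p.2.val < m - m' then (K ⟨p.2.val, h⟩ p.1).val
  else if p.2.val < targetCount r m m' p.1 then target r m' d p.1 else 0

theorem StarCond.le_target {r m m' d : ℕ}
    (hdr : d ≤ r) {K : Fin (m - m') → Fin d → Fin (2 * r)} (hK : StarCond r m' (m - m') d K)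
    (s : Fin (m - m')) (i : Fin d) : (K s i).val ≤ target r m' d i := by
  obtain ⟨h1, -, h3⟩ := hK
  unfold target
  have hi := i.isLt
  split_ifs with h
  · have := h3 i (by omega) s
    omega
  · have hT : StrictMono fun i => (K s i).val := fun i j hij => h1 s i j hij
    have := add_le_of_strictMono hT i ⟨d - 1, by omega⟩
      (by rw [Fin.le_def]; simp only; omega)
    simp only at this
    have := (K s ⟨d - 1, by omega⟩).isLt
    omega

theorem StarCond.isPartialArray {r m m' d N : ℕ} (hm' : m' ≤ m) (hmr : m ≤ r)
    (hdr : d ≤ r) (hN : N = m + d) {K : Fin (m - m') → Fin d → Fin (2 * r)}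
    (hK : StarCond r m' (m - m') d K) :
    IsPartialArray (height r m r) (fun i : Fin d => target r m' d i)
      (extendArray K : Fin d × Fin N → ℕ) := by
  have hle := hK.le_target hdr
  obtain ⟨h1, h2, -⟩ := hK
  have hc := fun i : Fin d => (height_target (m' := m') hm' hmr hdr i.isLt).1
  have hcM : ∀ i : Fin d, m - m' ≤ targetCount r m m' i := by
    intro i; unfold targetCount; split_ifs <;> omega
  refine ⟨fun i => ?_, fun i s hs => ?_, fun i s hs => ?_, fun i s t hst ht => ?_,
    fun i j hij s hs hs' => ?_, fun i b hb hM => ?_⟩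
  · rw [hc]; omega
  · simp only [extendArray]
    split_ifs
    · exact hle _ _
    · exact le_rfl
    · exact Nat.zero_le _
  · rw [hc] at hs
    have := hcM i
    simp only [extendArray]
    rw [dif_neg (by omega), if_neg (by omega)]
  · rw [hc] at ht
    have hst' : s.val ≤ t.val := hst
    simp only [extendArray]
    split_ifs
    · exact h2 i _ _ (by rw [Fin.le_def]; exact hst')
    · exact hle _ _
    all_goals omega
  · rw [hc] at hs hs'
    simp only [extendArray]
    split_ifs with g1
    · exact h1 _ i j (by rw [Fin.lt_def]; omega)
    · exact strictMono_target hdr (by rw [Fin.lt_def]; omega)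
    all_goals omega
  · have hi := i.isLt
    have : m - m' + 1 ≤ targetCount r m m' i ∧ targetCount r m m' i ≤ m + i.val := by
      revert hM
      rw [← hb, show b = target r m' d i - 1 by omega]
      unfold target targetCount height letterAt
      unfold target at hb
      split_ifs at hb ⊢ <;> omega
    refine ⟨⟨targetCount r m m' i - 1, by omega⟩, ?_, ?_⟩
    · rw [hc]; simp only; omega
    · simp only [extendArray]
      rw [dif_neg (by omega), if_pos (by omega)]

theorem IsPartialArray.starCond {r m m' d N : ℕ} (hm' : m' ≤ m) (hmr : m ≤ r)
    (hdr : d ≤ r) (hN : m - m' ≤ N) {K : Fin d × Fin N → ℕ}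
    (hK : IsPartialArray (height r m r) (fun i : Fin d => target r m' d i) K)
    (K' : Fin (m - m') → Fin d → Fin (2 * r))
    (hK' : ∀ s i, (K' s i).val = K (i, Fin.castLE hN s)) :
    StarCond r m' (m - m') d K' := by
  have hc := fun i : Fin d => (height_target (m' := m') hm' hmr hdr i.isLt).1
  have hcM : ∀ i : Fin d, m - m' ≤ targetCount r m m' i := by
    intro i; unfold targetCount; split_ifs <;> omega
  have hlt : ∀ i : Fin d, ∀ s : Fin (m - m'),
      ((Fin.castLE hN s).val : ℤ) < height r m r (target r m' d i) + i.val := by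
    intro i s
    have := hcM i
    have := s.isLt
    rw [hc, Fin.val_castLE]; omega
  refine ⟨fun s => ?_, fun i s t hst => ?_, fun i hi s => ?_⟩
  · have : StrictMono fun i => (K' s i).val := by
      refine strictMono_of_lt_succ fun i j hij => ?_
      simp only [hK']
      exact hK.strict i j hij _ (hlt i s) (hlt j s)
    exact fun i j hij => this hij
  · rw [Fin.le_def, hK', hK']
    exact hK.mono i _ _ hst (hlt i t)
  · rw [hK']
    have := hK.le_pos i _ (hlt i s)
    simp only [target] at this
    rw [if_pos (by omega)] at this
    omega

/-- `δ_i` separates the unbarred from the barred entries of a weakly increasing column. -/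
theorem succ_le_delta_iff {r M d : ℕ} {K : Fin M → Fin d → Fin (2 * r)} {i : Fin d}
    (h : ∀ s t : Fin M, s ≤ t → K s i ≤ K t i) (s : Fin M) :
    s.val + 1 ≤ delta K i ↔ (K s i).val < r := by
  unfold delta
  constructor
  · intro hs
    by_contra hlt
    have : (Finset.univ.filter fun s : Fin M => (K s i).val < r) ⊆ Finset.Iio s := by
      intro t ht
      rw [Finset.mem_filter] at ht
      rw [Finset.mem_Iio]
      by_contra hst
      have : (K s i).val ≤ (K t i).val := h s t (not_lt.1 hst)
      omega
    have := Finset.card_le_card this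
    rw [Fin.card_Iio] at this
    omega
  · intro hlt
    have : Finset.Iic s ⊆ (Finset.univ.filter fun s : Fin M => (K s i).val < r) := by
      intro t ht
      rw [Finset.mem_Iic] at ht
      rw [Finset.mem_filter]
      have : (K t i).val ≤ (K s i).val := h t s ht
      exact ⟨Finset.mem_univ _, by omega⟩
    have := Finset.card_le_card this
    rwa [Fin.card_Iic] at this

theorem stayWt_coordWt_of_lt {r m : ℕ} (w : List (Fin r)) (Y : Fin w.length → ℂˣ) {a : ℕ}
    (ha : a < r) (h : ℤ) : stayWt (coordWt m w Y) a h = Cbar w Y (m - (a + h)) (a + 1) := by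
  unfold stayWt coordWt Cbar
  rw [if_pos (by omega), if_pos (by omega)]
  congr 2
  · ring
  · ring
  · push_cast; ring

theorem stayWt_coordWt_of_le {r m : ℕ} (w : List (Fin r)) (Y : Fin w.length → ℂˣ) {a : ℕ}
    (ha : r ≤ a) (h : ℤ) :
    stayWt (coordWt m w Y) a h = Cmon w Y (m - (h + r)) (2 * r - a - 1) := by
  unfold stayWt coordWt Cmon
  rw [if_neg (by omega : ¬ a + 1 ≤ r)]
  congr 1
  · split_ifs
    · obtain rfl : a = r := by omega
      congr 1 <;> ring
    · congr 1 <;> ring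
  · congr 1
    · ring
    · push_cast; ring

theorem StarCond.stayWt_eq {r m m' d : ℕ} (w : List (Fin r)) (Y : Fin w.length → ℂˣ)
    {K : Fin (m - m') → Fin d → Fin (2 * r)} (hK : StarCond r m' (m - m') d K)
    (s : Fin (m - m')) (i : Fin d) :
    stayWt (coordWt m w Y) (K s i).val ((s.val : ℤ) - i.val) =
      if s.val + 1 ≤ delta K i then Cbar w Y ((m : ℤ) - ell K s i) (letterAbs (K s i))
      else Cmon w Y ((m : ℤ) - ell K s i) (letterAbs (K s i) - 1) := by
  unfold ell letterAbs
  simp only [succ_le_delta_iff (hK.2.1 i)]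
  split_ifs with h
  · rw [stayWt_coordWt_of_lt w Y h]
    congr 1; ring
  · rw [stayWt_coordWt_of_le w Y (not_lt.1 h)]
    congr 1; ring

theorem prod_fin_ite_lt {M N : ℕ} (h : M ≤ N) (f : Fin N → ℂ) :
    ∏ s : Fin N, (if s.val < M then f s else 1) = ∏ s : Fin M, f (Fin.castLE h s) := by
  obtain ⟨k, rfl⟩ := Nat.exists_eq_add_of_le h
  rw [Fin.prod_univ_add]
  simp only [Fin.val_castAdd, Fin.is_lt, if_true, Fin.val_natAdd, Nat.not_lt.2 (Nat.le_add_right _ _),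
    if_false, Finset.prod_const_one, mul_one]
  rfl

/-- The forced weights of column `i` are a quotient of consecutive terms of a sequence `q`, so their
product over the columns telescopes. -/
theorem prod_forced_column {r m m' d N : ℕ} (hm' : m' ≤ m) (hmr : m ≤ r) (hdr : d ≤ r)
    (hN : N = m + d) (w : List (Fin r)) (Y : Fin w.length → ℂˣ) (q : ℕ → ℂ)
    (hq : q = fun i => ∏ t ∈ Finset.range (i + m' - r), Yc w Y (t + 1) (d - i)) (i : Fin d) :
    ∏ s : Fin N, (if m - m' ≤ s.val ∧ s.val < targetCount r m m' i then
      stayWt (coordWt m w Y) (target r m' d i) ((s.val : ℤ) - i.val) else 1) =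
      q i.val / q (i.val + 1) := by
  have hi := i.isLt
  by_cases hir : m' + i.val < r
  · have e1 : i.val + m' - r = 0 := by omega
    have e2 : i.val + 1 + m' - r = 0 := by omega
    rw [hq]
    simp only [e1, e2, Finset.range_zero, Finset.prod_empty, div_one]
    refine Finset.prod_eq_one fun s _ => if_neg ?_
    rw [targetCount, if_pos hir]
    omega
  · have hc : targetCount r m m' i = m + 1 + i.val - r := by rw [targetCount, if_neg hir]
    have ht : target r m' d i = 2 * r - d + i.val := by rw [target, if_neg hir]
    rw [hc, ht]
    rw [Fin.prod_univ_eq_prod_range (fun s : ℕ => if m - m' ≤ s ∧ s < m + 1 + i.val - r then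
      stayWt (coordWt m w Y) (2 * r - d + i.val) ((s : ℤ) - i.val) else 1) N,
      ← Finset.prod_filter]
    have e1 : (Finset.range N).filter (fun s => m - m' ≤ s ∧ s < m + 1 + i.val - r) =
        Finset.Ico (m - m') (m + 1 + i.val - r) := by
      ext s
      simp only [Finset.mem_filter, Finset.mem_range, Finset.mem_Ico]
      omega
    rw [e1, Finset.prod_Ico_eq_prod_range,
      show m + 1 + i.val - r - (m - m') = (i.val + m' - r) + 1 by omega,
      ← Finset.prod_range_reflect]
    have e2 : ∀ t ∈ Finset.range (i.val + m' - r + 1),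
        stayWt (coordWt m w Y) (2 * r - d + i.val)
          (((m - m' + (i.val + m' - r + 1 - 1 - t) : ℕ) : ℤ) - i.val) =
        Yc w Y t (d - i.val) / Yc w Y (t + 1) (d - (i.val + 1)) := by
      intro t ht
      rw [Finset.mem_range] at ht
      rw [stayWt_coordWt_of_le w Y (by omega), Cmon]
      congr 2 <;> omega
    rw [Finset.prod_congr rfl e2, Finset.prod_div_distrib, hq]
    have e3 : i.val + 1 + m' - r = i.val + m' - r + 1 := by omega
    simp only [e3]
    congr 1
    rw [Finset.prod_range_succ', Yc_eq_one _ _ _ _ (Or.inl (by simp)), mul_one]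
    simp

theorem prod_forced {r m m' d N : ℕ} (hm' : m' ≤ m) (hmr : m ≤ r) (hdr : d ≤ r)
    (hN : N = m + d) (w : List (Fin r)) (Y : Fin w.length → ℂˣ) :
    ∏ i : Fin d, ∏ s : Fin N, (if m - m' ≤ s.val ∧ s.val < targetCount r m m' i then
      stayWt (coordWt m w Y) (target r m' d i) ((s.val : ℤ) - i.val) else 1) = 1 := by
  obtain ⟨q, hq⟩ : ∃ q : ℕ → ℂ,
    q = fun i => ∏ t ∈ Finset.range (i + m' - r), Yc w Y (t + 1) (d - i) := ⟨_, rfl⟩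
  rw [Finset.prod_congr rfl fun i _ => prod_forced_column hm' hmr hdr hN w Y q hq i,
    Fin.prod_univ_eq_prod_range (fun i => q i / q (i + 1)) d]
  have hq0 : ∀ n, q n ≠ 0 := by
    intro n
    rw [hq]
    exact Finset.prod_ne_zero_iff.2 fun t _ => Yc_ne_zero _ _ _ _
  have htel : ∀ n, ∏ i ∈ Finset.range n, q i / q (i + 1) = q 0 / q n := by
    intro n
    induction n with
    | zero => simp [hq0]
    | succ n ih => rw [Finset.prod_range_succ, ih, div_mul_div_cancel₀ (hq0 n)]
  rw [htel]
  have e1 : q 0 = 1 := by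
    rw [hq]
    simp only [show 0 + m' - r = 0 by omega, Finset.range_zero, Finset.prod_empty]
  have e2 : q d = 1 := by
    rw [hq]
    exact Finset.prod_eq_one fun t _ => Yc_eq_one _ _ _ _ (Or.inr (by simp))
  rw [e1, e2, div_one]

theorem arrayWt_extendArray {r m m' d N : ℕ} (hm' : m' ≤ m) (hmr : m ≤ r) (hdr : d ≤ r)
    (hN : N = m + d) (w : List (Fin r)) (Y : Fin w.length → ℂˣ)
    {K : Fin (m - m') → Fin d → Fin (2 * r)} (hK : StarCond r m' (m - m') d K) :
    arrayWt (coordWt m w Y) (height r m r) (fun i : Fin d => target r m' d i)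
      (extendArray K : Fin d × Fin N → ℕ) = arrayMonomial m w Y K := by
  have hMN : m - m' ≤ N := by omega
  have hc := fun i : Fin d => (height_target (m' := m') hm' hmr hdr i.isLt).1
  have hcM : ∀ i : Fin d, m - m' ≤ targetCount r m m' i := by
    intro i; unfold targetCount; split_ifs <;> omega
  unfold arrayWt
  rw [Fintype.prod_prod_type]
  have : ∀ i : Fin d, ∀ s : Fin N, (if (s.val : ℤ) < height r m r (target r m' d i) + i.val then
        stayWt (coordWt m w Y) (extendArray K (i, s)) ((s.val : ℤ) - i.val) else 1) =
      (if s.val < m - m' then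
        stayWt (coordWt m w Y) (extendArray K (i, s)) ((s.val : ℤ) - i.val) else 1) *
      (if m - m' ≤ s.val ∧ s.val < targetCount r m m' i then
        stayWt (coordWt m w Y) (target r m' d i) ((s.val : ℤ) - i.val) else 1) := by
    intro i s
    have := hcM i
    rw [hc]
    by_cases h1 : s.val < m - m'
    · rw [if_pos (by omega), if_pos h1, if_neg (by omega), mul_one]
    · rw [if_neg h1, one_mul]
      by_cases h2 : s.val < targetCount r m m' i
      · rw [if_pos (by omega), if_pos (by omega)]
        simp only [extendArray, h1, h2, dif_neg, if_true, not_false_eq_true]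
      · rw [if_neg (by omega), if_neg (by omega)]
  simp only [this, Finset.prod_mul_distrib]
  rw [prod_forced hm' hmr hdr hN, mul_one, arrayMonomial]
  refine Finset.prod_congr rfl fun i _ => ?_
  rw [prod_fin_ite_lt hMN]
  refine Finset.prod_congr rfl fun s _ => ?_
  rw [← hK.stayWt_eq w Y s i]
  simp [extendArray]

/-- At the extremal rows the records of stays are the arrays `(*)`, with the monomials of the
theorem as weights. -/
theorem arraySum_target {r m m' d : ℕ} (hm' : m' ≤ m) (hmr : m ≤ r)
    (hdr : d ≤ r) (w : List (Fin r)) (Y : Fin w.length → ℂˣ) :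
    arraySum (2 * r) (m + d) (coordWt m w Y) (height r m r)
        (fun i : Fin d => target r m' d i) =
      ∑ K : Fin (m - m') → Fin d → Fin (2 * r) with StarCond r m' (m - m') d K,
        arrayMonomial m w Y K := by
  have hTL : ∀ i : Fin d, target r m' d i < 2 * r := fun i => target_lt hdr i.isLt
  have hMN : m - m' ≤ m + d := by omega
  have hc := fun i : Fin d => (height_target (m' := m') hm' hmr hdr i.isLt).1
  have hcM : ∀ i : Fin d, m - m' ≤ targetCount r m m' i := by
    intro i; unfold targetCount; split_ifs <;> omega
  unfold arraySum
  rw [Finset.prod_eq_one fun i _ => pendingWt_target hdr i.isLt w Y, one_mul]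
  symm
  have hlt : ∀ K ∈ partialArrays (2 * r) (m + d) (height r m r)
      (fun i : Fin d => target r m' d i), ∀ p, K p < 2 * r := by
    intro K hK p
    classical
    unfold partialArrays at hK
    have := (Finset.mem_filter.1 hK).1
    exact Finset.mem_range.1 (Fintype.mem_piFinset.1 this p)
  refine Finset.sum_bij' (fun K _ => extendArray K)
    (fun K hK s i => ⟨K (i, Fin.castLE hMN s), hlt K hK _⟩) ?_ ?_ ?_ ?_ ?_
  · intro K hK
    rw [Finset.mem_filter] at hK
    rw [mem_partialArrays hTL]
    exact hK.2.isPartialArray hm' hmr hdr rfl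
  · intro K hK
    rw [Finset.mem_filter]
    rw [mem_partialArrays hTL] at hK
    exact ⟨Finset.mem_univ _, hK.starCond hm' hmr hdr hMN _ fun _ _ => rfl⟩
  · intro K hK
    funext s i
    ext
    simp [extendArray]
  · intro K hK
    rw [mem_partialArrays hTL] at hK
    funext ⟨i, s⟩
    simp only [extendArray]
    split_ifs with h1 h2
    · rfl
    · exact (hK.eq_target hm' hmr hdr i s (by omega) h2).symm
    · refine (hK.eq_zero i s ?_).symm
      rw [hc]; omega
  · intro K hK
    rw [Finset.mem_filter] at hK
    exact (arrayWt_extendArray hm' hmr hdr rfl w Y hK.2).symm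

/-! ### Moving the leading minor to the extremal rows -/

/-- The action on rows of the inverse of `s̄` for the pair of positions `a`, `a + 1`. -/
def swapOp {d : ℕ} (a : ℕ) (R : ℕ → Fin d → ℂ) : ℕ → Fin d → ℂ := fun b =>
  if b = a then R (a + 1) else if b = a + 1 then -R a else R b

theorem rowsOf_eMat_mul {r d : ℕ} (hd : d ≤ 2 * r) (i : Fin r)
    (g : Matrix (Fin (2 * r)) (Fin (2 * r)) ℂ) (b : ℕ) :
    rowsOf hd (eMat i * g) b = (if b = i.val then rowsOf hd g (i.val + 1) else 0) +
      (if i.val + 1 < r ∧ b = 2 * r - 2 - i.val then rowsOf hd g (2 * r - 1 - i.val) else 0) := by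
  have hi := i.isLt
  have e : 2 * r - 2 - i.val = 2 * r - 1 - (i.val + 1) := by omega
  by_cases h : i.val + 1 < r
  · simp only [eMat, h, dif_pos, Matrix.add_mul, rowsOf_add, rowsOf_single_mul, un, bar, e,
      true_and]
  · have e' : 2 * r - 1 - i.val = i.val + 1 := by omega
    simp only [eMat, h, dif_neg, not_false_eq_true, rowsOf_single_mul, un, bar, e',
      false_and, if_false, add_zero]

theorem rowsOf_xPos_mul {r d : ℕ} (hd : d ≤ 2 * r) (i : Fin r) (t : ℂ)
    (g : Matrix (Fin (2 * r)) (Fin (2 * r)) ℂ) (b : ℕ) :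
    rowsOf hd ((xPos i t).val.val * g) b = rowsOf hd g b +
      t • ((if b = i.val then rowsOf hd g (i.val + 1) else 0) +
      (if i.val + 1 < r ∧ b = 2 * r - 2 - i.val then rowsOf hd g (2 * r - 1 - i.val) else 0)) := by
  rw [xPos_val, Matrix.add_mul, Matrix.one_mul, Matrix.smul_mul, rowsOf_add, rowsOf_smul,
    rowsOf_eMat_mul]

theorem rowsOf_yNeg_mul {r d : ℕ} (hd : d ≤ 2 * r) (i : Fin r) (t : ℂ)
    (g : Matrix (Fin (2 * r)) (Fin (2 * r)) ℂ) (b : ℕ) :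
    rowsOf hd ((yNeg i t).val.val * g) b = rowsOf hd g b +
      t • ((if b = i.val + 1 then rowsOf hd g i.val else 0) +
      (if i.val + 1 < r ∧ b = 2 * r - 1 - i.val then rowsOf hd g (2 * r - 2 - i.val) else 0)) := by
  rw [yNeg_val, Matrix.add_mul, Matrix.one_mul, Matrix.smul_mul, rowsOf_add, rowsOf_smul,
    rowsOf_fMat_mul]

theorem xPos_mul_xPos_neg {r : ℕ} (i : Fin r) (t : ℂ) : xPos i t * xPos i (-t) = 1 := by
  refine Subtype.ext (Units.ext ?_)
  change (xPos i t).val.val * (xPos i (-t)).val.val = 1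
  rw [xPos_val, xPos_val]
  simp [Matrix.add_mul, Matrix.mul_add, eMat_sq]

theorem yNeg_mul_yNeg_neg {r : ℕ} (i : Fin r) (t : ℂ) : yNeg i t * yNeg i (-t) = 1 := by
  refine Subtype.ext (Units.ext ?_)
  change (yNeg i t).val.val * (yNeg i (-t)).val.val = 1
  rw [yNeg_val, yNeg_val]
  simp [Matrix.add_mul, Matrix.mul_add, fMat_sq]

theorem sBar_inv {r : ℕ} (i : Fin r) :
    (sBar i)⁻¹ = xPos i 1 * yNeg i (-1) * xPos i 1 := by
  have h1 : (xPos i (-1))⁻¹ = xPos i 1 := by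
    rw [inv_eq_iff_mul_eq_one]
    simpa using xPos_mul_xPos_neg i (-1)
  have h2 : (yNeg i 1)⁻¹ = yNeg i (-1) := by
    rw [inv_eq_iff_mul_eq_one]
    exact yNeg_mul_yNeg_neg i 1
  rw [sBar, mul_inv_rev, mul_inv_rev, h1, h2, mul_assoc]

theorem rowsOf_sBar_inv_mul {r d : ℕ} (hd : d ≤ 2 * r) (i : Fin r) (g : Sp r) :
    rowsOf hd ((sBar i)⁻¹ * g).val.val =
      if i.val + 1 < r then swapOp i.val (swapOp (2 * r - 2 - i.val) (rowsOf hd g.val.val))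
      else swapOp i.val (rowsOf hd g.val.val) := by
  have hi := i.isLt
  have e : ((sBar i)⁻¹ * g).val.val =
      (xPos i 1).val.val * ((yNeg i (-1)).val.val * ((xPos i 1).val.val * g.val.val)) := by
    rw [sBar_inv, mul_assoc, mul_assoc]; rfl
  rw [e]
  generalize g.val.val = A
  funext b
  simp only [rowsOf_xPos_mul, rowsOf_yNeg_mul]
  generalize rowsOf hd A = R
  by_cases h : i.val + 1 < r
  · simp only [h, true_and, if_true, swapOp]
    have f1 : ¬ (i.val = 2 * r - 2 - i.val) := by omega
    have f2 : ¬ (i.val = 2 * r - 2 - i.val + 1) := by omega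
    have f4 : 2 * r - 2 - i.val + 1 = 2 * r - 1 - i.val := by omega
    have f5 : ¬ (i.val = 2 * r - 1 - i.val) := by omega
    have f6 : ¬ (i.val + 1 = 2 * r - 1 - i.val) := by omega
    have f7 : ¬ (i.val + 1 = 2 * r - 2 - i.val) := by omega
    have f8 : ¬ (2 * r - 2 - i.val = i.val) := by omega
    have f9 : ¬ (2 * r - 1 - i.val = i.val) := by omega
    have f10 : ¬ (2 * r - 1 - i.val = i.val + 1) := by omega
    have f11 : ¬ (2 * r - 2 - i.val = i.val + 1) := by omega
    have f12 : ¬ (2 * r - 2 - i.val = 2 * r - 1 - i.val) := by omega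
    have f13 : ¬ (2 * r - 1 - i.val = 2 * r - 2 - i.val) := by omega
    by_cases b1 : b = i.val
    · subst b1
      simp [f1, f5, f6, f7]
    · by_cases b2 : b = i.val + 1
      · subst b2
        simp [f1, f2, f6, f7]
      · by_cases b3 : b = 2 * r - 2 - i.val
        · subst b3
          simp [f4, f8, f9, f10, f11, f12, f13]
        · by_cases b4 : b = 2 * r - 1 - i.val
          · subst b4
            simp [f4, f8, f9, f10, f13]
          · simp [b1, b2, b3, b4, f4]
  · simp only [h, false_and, if_false, add_zero, swapOp]
    by_cases b1 : b = i.val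
    · subst b1; simp
    · by_cases b2 : b = i.val + 1
      · subst b2; simp
      · simp [b1, b2]

theorem rowMinor_swapOp_of_forall {d : ℕ} (a : ℕ) (R : ℕ → Fin d → ℂ) {T T' : Fin d → ℕ}
    (h : ∀ j, (T j = a ∧ T' j = a + 1) ∨ (T j ≠ a ∧ T j ≠ a + 1 ∧ T' j = T j)) :
    rowMinor (swapOp a R) T = rowMinor R T' := by
  unfold rowMinor
  congr 2
  funext j
  rcases h j with ⟨h1, h2⟩ | ⟨h1, h2, h3⟩
  · rw [swapOp, if_pos h1, h2]
  · rw [swapOp, if_neg h1, if_neg h2, h3]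

theorem rowMinor_swapOp_of_mem_of_mem {d : ℕ} (a : ℕ) (R : ℕ → Fin d → ℂ)
    {T : Fin d → ℕ} (hT : StrictMono T) {i k : Fin d} (hi : T i = a) (hk : T k = a + 1) :
    rowMinor (swapOp a R) T = rowMinor R T := by
  have hik : i ≠ k := by rintro rfl; omega
  have : (Matrix.of fun j => swapOp a R (T j)) =
      ((Matrix.of fun j => R (T j)).submatrix (Equiv.swap i k) id).updateRow k
        ((-1 : ℂ) • ((Matrix.of fun j => R (T j)).submatrix (Equiv.swap i k) id) k) := by
    ext j l
    by_cases hjk : j = k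
    · subst hjk
      simp [swapOp, hk, hi]
    · rw [Matrix.updateRow_ne hjk]
      by_cases hj : j = i
      · subst hj; simp [swapOp, hi, hk]
      · have h1 : T j ≠ a := fun h => hj (hT.injective (h.trans hi.symm))
        have h3 : T j ≠ a + 1 := fun h => hjk (hT.injective (h.trans hk.symm))
        simp [swapOp, h1, h3, Equiv.swap_apply_of_ne_of_ne hj hjk]
  rw [rowMinor, this, Matrix.det_updateRow_smul, Matrix.updateRow_eq_self,
    Matrix.det_permute, Equiv.Perm.sign_swap hik, rowMinor]
  simp

/-- The position of the row `i` of the leading minor after the last `p` cycles of the word of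
`w` (the incomplete one included) and the letters `≥ l` of the cycle before them have been undone. -/
def weylPos (r d p l i : ℕ) : ℕ :=
  if r ≤ p + i then 2 * r - d + i
  else if p + i + 1 = r then min (2 * r - 1 - l) (2 * r - d + i)
  else if l ≤ p + i then p + i + 1 else p + i

theorem strictMono_weylPos {r d p l : ℕ} (hdr : d ≤ r) (hl : l ≤ r) :
    StrictMono fun i : Fin d => weylPos r d p l i := by
  intro i j hij
  have : i.val < j.val := hij
  have := j.isLt
  simp only [weylPos]
  split_ifs <;> omega

theorem rowMinor_swapOp_weylPos_mid {r d p : ℕ} (hp : p < r) (hdr : d ≤ r) (R : ℕ → Fin d → ℂ) :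
    rowMinor (swapOp (r - 1) R) (fun i : Fin d => weylPos r d p r i) =
      rowMinor R (fun i : Fin d => weylPos r d p (r - 1) i) := by
  refine rowMinor_swapOp_of_forall _ _ fun j => ?_
  have := j.isLt
  simp only [weylPos]
  split_ifs <;> omega

theorem rowMinor_swapOp_weylPos {r d p l : ℕ} (hp : p < r) (hl : l + 1 < r) (hdr : d ≤ r)
    (R : ℕ → Fin d → ℂ) :
    rowMinor (swapOp l (swapOp (2 * r - 2 - l) R)) (fun i : Fin d => weylPos r d p (l + 1) i) =
      rowMinor R (fun i : Fin d => weylPos r d p l i) := by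
  rw [rowMinor_swapOp_of_forall l _ (T' := fun i : Fin d =>
    if weylPos r d p (l + 1) i = l then l + 1 else weylPos r d p (l + 1) i)]
  swap
  · intro j
    have := j.isLt
    simp only [weylPos]
    split_ifs <;> omega
  by_cases hb : r + l + 1 ≤ d + p ∧ l + 2 ≤ d
  · have hpos : (fun i : Fin d =>
        if weylPos r d p (l + 1) i = l then l + 1 else weylPos r d p (l + 1) i) =
        fun i : Fin d => weylPos r d p l i := by
      funext i
      have := i.isLt
      simp only [weylPos]
      split_ifs <;> omega
    rw [hpos]
    refine rowMinor_swapOp_of_mem_of_mem _ _ (strictMono_weylPos hdr (by omega))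
      (i := ⟨d - 2 - l, by omega⟩) (k := ⟨d - 1 - l, by omega⟩) ?_ ?_
    · simp only [weylPos]
      split_ifs <;> omega
    · simp only [weylPos]
      split_ifs <;> omega
  · refine rowMinor_swapOp_of_forall _ _ fun j => ?_
    have := j.isLt
    simp only [weylPos]
    split_ifs <;> omega

theorem rowMinor_weylRep_inv_mul {r m d : ℕ} (hd : 1 ≤ d) (hdr : d ≤ r) {m' : ℕ} (h1 : 1 ≤ m')
    (hm' : m' ≤ m) (hmr : m ≤ r) (g : Sp r) :
    rowMinor (rowsOf (by omega : d ≤ 2 * r)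
      ((weylRep ((cycWord r m d).take ((m' - 1) * r + d)))⁻¹ * g).val.val) (fun i => i.val) =
      rowMinor (rowsOf (by omega : d ≤ 2 * r) g.val.val) (fun i => target r m' d i) := by
  have hd' : d ≤ 2 * r := by omega
  have hlen := length_cycWord (r := r) (m := m) hdr
  obtain ⟨P, hP⟩ : ∃ P : ℕ → ℕ → Prop, P = fun p l => ∀ c, c + p + 1 = m' →
      rowMinor (rowsOf hd'
        ((weylRep ((cycWord r m d).take ((m' - 1) * r + d)))⁻¹ * g).val.val) (fun i => i.val) =
      rowMinor (rowsOf hd' ((weylRep ((cycWord r m d).take (c * r + l)))⁻¹ * g).val.val)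
        (fun i => weylPos r d p l i) := ⟨_, rfl⟩
  have hstep : ∀ p l, l < r → (p = 0 → l < d) → P p (l + 1) → P p l := by
    intro p l hl hτ h
    rw [hP] at h ⊢
    intro c hc
    have hlt : c * r + l < (cycWord r m d).length := by
      rw [hlen]
      rcases Nat.eq_zero_or_pos p with h0 | h0
      · have := hτ h0
        have : c * r ≤ (m - 1) * r := Nat.mul_le_mul_right _ (by omega)
        omega
      · have : (c + 1) * r ≤ (m - 1) * r := Nat.mul_le_mul_right _ (by omega)
        rw [Nat.add_mul] at this; omega
    rw [h c hc]
    have e : weylRep ((cycWord r m d).take (c * r + (l + 1))) =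
        weylRep ((cycWord r m d).take (c * r + l)) * sBar ⟨l, hl⟩ := by
      rw [weylRep, weylRep, ← add_assoc, List.take_succ_eq_append_getElem hlt, List.map_append,
        List.prod_append]
      congr 1
      simp only [List.map_cons, List.map_nil, List.prod_singleton]
      congr 1
      ext
      rw [getElem_cycWord hd hdr, Nat.mul_add_mod_of_lt hl]
    rw [e, mul_inv_rev, mul_assoc, rowsOf_sBar_inv_mul]
    simp only
    split_ifs with h2
    · exact rowMinor_swapOp_weylPos (by omega) h2 hdr _
    · obtain rfl : l = r - 1 := by omega
      rw [show r - 1 + 1 = r by omega]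
      exact rowMinor_swapOp_weylPos_mid (by omega) hdr _
  have hdesc : ∀ p l, l ≤ r → (p = 0 → l ≤ d) → P p l → P p 0 := by
    intro p l
    induction l with
    | zero => exact fun _ _ h => h
    | succ l ih =>
      intro h1 h2 h3
      exact ih (by omega) (fun h => by have := h2 h; omega)
        (hstep p l (by omega) (fun h => by have := h2 h; omega) h3)
  have hmain : ∀ p, p < m' → P p 0 := by
    intro p
    induction p with
    | zero =>
      intro _
      refine hdesc 0 d hdr (fun _ => le_rfl) ?_
      rw [hP]
      intro c hc
      rw [show c = m' - 1 by omega]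
      congr 1
      funext i
      have := i.isLt
      simp only [weylPos]
      split_ifs <;> omega
    | succ p ih =>
      intro h
      refine hdesc (p + 1) r le_rfl (fun h => by omega) ?_
      have := ih (by omega)
      rw [hP] at this ⊢
      intro c hc
      rw [this (c + 1) (by omega), Nat.add_mul, one_mul, add_zero]
      congr 1
      funext i
      have := i.isLt
      simp only [weylPos]
      split_ifs <;> omega
  have h0 := hmain (m' - 1) (by omega)
  rw [hP] at h0
  rw [h0 0 (by omega), zero_mul, add_zero, List.take_zero]
  have : weylRep ([] : List (Fin r)) = 1 := rfl
  rw [this, inv_one, one_mul]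
  congr 1
  funext i
  have := i.isLt
  simp only [weylPos, target]
  split_ifs <;> omega

/-! ### Gauss decomposition and uniqueness of generalized minors -/

theorem sum_eq_sum_castLE {k n : ℕ} (hk : k ≤ n) (f : Fin n → ℂ)
    (hf : ∀ s : Fin n, k ≤ s.val → f s = 0) : ∑ s, f s = ∑ s : Fin k, f (Fin.castLE hk s) := by
  obtain ⟨j, rfl⟩ := Nat.exists_eq_add_of_le hk
  rw [Fin.sum_univ_add, Finset.sum_eq_zero (s := Finset.univ) (f := fun i => f (Fin.natAdd k i)),
    add_zero]
  · rfl
  · intro i _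
    exact hf _ (by simp)

theorem det_of_forall_lt_eq_zero {n : ℕ} (A : Matrix (Fin n) (Fin n) ℂ)
    (h : ∀ p q, p < q → A p q = 0) : A.det = ∏ p, A p p :=
  Matrix.det_of_isLowerTriangular A fun p q hpq => h p q hpq

theorem det_of_forall_gt_eq_zero {n : ℕ} (A : Matrix (Fin n) (Fin n) ℂ)
    (h : ∀ p q, q < p → A p q = 0) : A.det = ∏ p, A p p :=
  Matrix.det_of_isUpperTriangular fun p q hpq => h p q hpq

/-- Elimination by columns: the column `q` of `U` solves the linear system of the leading `q × q`
block of `A` that makes the entries above the diagonal vanish. -/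
theorem exists_upper_mul_lower {n : ℕ} (A : Matrix (Fin n) (Fin n) ℂ)
    (hA : ∀ k (hk : k ≤ n), (A.submatrix (Fin.castLE hk) (Fin.castLE hk)).det ≠ 0) :
    ∃ U : Matrix (Fin n) (Fin n) ℂ, (∀ p, U p p = 1) ∧ (∀ p q, q < p → U p q = 0) ∧
      (∀ p q, p < q → (A * U) p q = 0) ∧ ∀ p, (A * U) p p ≠ 0 := by
  obtain ⟨u, hu⟩ : ∃ u : ∀ q : Fin n, Fin q.val → ℂ, u = fun q =>
    (A.submatrix (Fin.castLE q.isLt.le) (Fin.castLE q.isLt.le))⁻¹ *ᵥ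
      fun p => -A (Fin.castLE q.isLt.le p) q := ⟨_, rfl⟩
  obtain ⟨U, hU⟩ : ∃ U : Matrix (Fin n) (Fin n) ℂ, U = Matrix.of fun p q =>
    (∑ j : Fin q.val, if p = Fin.castLE q.isLt.le j then u q j else 0) +
      if p = q then 1 else 0 := ⟨_, rfl⟩
  have h1 : ∀ p, U p p = 1 := by
    intro p
    rw [hU, Matrix.of_apply, if_pos rfl, Finset.sum_eq_zero, zero_add]
    intro j _
    rw [if_neg]
    intro h
    have := congrArg Fin.val h
    have := j.isLt
    simp only [Fin.val_castLE] at *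
    omega
  have h2 : ∀ p q, q < p → U p q = 0 := by
    intro p q hqp
    rw [hU, Matrix.of_apply, if_neg hqp.ne', Finset.sum_eq_zero, zero_add]
    intro j _
    rw [if_neg]
    intro h
    have := congrArg Fin.val h
    have := j.isLt
    have : q.val < p.val := hqp
    simp only [Fin.val_castLE] at *
    omega
  have h3 : ∀ p q, p < q → (A * U) p q = 0 := by
    intro p q hpq
    have hdet : IsUnit (A.submatrix (Fin.castLE q.isLt.le) (Fin.castLE q.isLt.le)).det :=
      isUnit_iff_ne_zero.2 (hA _ _)
    have e1 : (A.submatrix (Fin.castLE q.isLt.le) (Fin.castLE q.isLt.le)) *ᵥ u q =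
        fun p => -A (Fin.castLE q.isLt.le p) q := by
      rw [hu, Matrix.mulVec_mulVec, Matrix.mul_nonsing_inv _ hdet, Matrix.one_mulVec]
    have e2 := congrFun e1 ⟨p.val, hpq⟩
    have e3 : Fin.castLE q.isLt.le ⟨p.val, hpq⟩ = p := rfl
    simp only [Matrix.mulVec, dotProduct, Matrix.submatrix_apply, e3] at e2
    rw [Matrix.mul_apply, hU]
    simp only [Matrix.of_apply, mul_add, Finset.sum_add_distrib, Finset.mul_sum]
    rw [Finset.sum_comm]
    simp only [mul_ite, mul_zero, Finset.sum_ite_eq', Finset.mem_univ, if_true,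
      mul_one, e2]
    ring
  refine ⟨U, h1, h2, h3, ?_⟩
  have hdU : U.det = 1 := by
    rw [det_of_forall_gt_eq_zero U h2]
    simp [h1]
  have hdA : A.det ≠ 0 := by
    have := hA n le_rfl
    have e : A.submatrix (Fin.castLE (le_refl n)) (Fin.castLE (le_refl n)) = A := by
      ext; rfl
    rwa [e] at this
  have hdet : (A * U).det ≠ 0 := by rw [Matrix.det_mul, hdU, mul_one]; exact hdA
  rw [det_of_forall_lt_eq_zero _ h3] at hdet
  intro p
  exact Finset.prod_ne_zero_iff.1 hdet p (Finset.mem_univ _)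

theorem sympForm_apply_of_ne {r : ℕ} {p q : Fin (2 * r)} (h : q ≠ p.rev) :
    sympForm r p q = 0 := by
  rw [sympForm, if_neg]
  intro h'
  apply h
  ext
  rw [Fin.val_rev]
  omega

theorem sympForm_rev_ne_zero {r : ℕ} (p : Fin (2 * r)) : sympForm r p p.rev ≠ 0 := by
  have := p.isLt
  rw [sympForm, if_pos (by rw [Fin.val_rev]; omega)]
  split_ifs
  · exact pow_ne_zero _ (by norm_num)
  · exact neg_ne_zero.2 (pow_ne_zero _ (by norm_num))

theorem sympForm_rev_mul {r : ℕ} (p : Fin (2 * r)) :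
    sympForm r p p.rev * sympForm r p.rev p = -1 := by
  have h := congrFun (congrFun (sympForm_mul_self r) p) p
  rw [Matrix.mul_apply, Finset.sum_eq_single p.rev] at h
  · simpa using h
  · intro q _ hq
    rw [sympForm_apply_of_ne hq, zero_mul]
  · simp

theorem mul_sympForm_mul_apply {r : ℕ} (A B : Matrix (Fin (2 * r)) (Fin (2 * r)) ℂ)
    (p q : Fin (2 * r)) :
    (A * sympForm r * B) p q = ∑ a, A p a * sympForm r a a.rev * B a.rev q := by
  rw [Matrix.mul_assoc, Matrix.mul_apply]
  refine Finset.sum_congr rfl fun a _ => ?_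
  rw [Matrix.mul_apply, Finset.sum_eq_single a.rev, mul_assoc]
  · intro b _ hb
    rw [sympForm_apply_of_ne hb, zero_mul]
  · simp

/-- If an upper unitriangular `U` and a lower triangular `B` transform the symplectic form into the
same form, both sides are supported on the antidiagonal, since the left one vanishes on one side of
it and the right one on the other. -/
theorem upper_lower_symp {r : ℕ} {U B : Matrix (Fin (2 * r)) (Fin (2 * r)) ℂ}
    (hU1 : ∀ p, U p p = 1) (hU : ∀ p q, q < p → U p q = 0) (hB : ∀ p q, p < q → B p q = 0)
    (h : Bᵀ * sympForm r * B = Uᵀ * sympForm r * U) :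
    Uᵀ * sympForm r * U = sympForm r ∧ ∀ p, B p p * B p.rev p.rev = 1 := by
  have hUd : ∀ p, (Uᵀ * sympForm r * U) p p.rev = sympForm r p p.rev := by
    intro p
    rw [mul_sympForm_mul_apply, Finset.sum_eq_single p]
    · simp [hU1]
    · intro a _ ha
      rcases lt_or_gt_of_ne ha with h1 | h1
      · rw [hU a.rev p.rev (Fin.rev_lt_rev.2 h1), mul_zero]
      · rw [Matrix.transpose_apply, hU a p h1, zero_mul, zero_mul]
    · simp
  have hBd : ∀ p, (Bᵀ * sympForm r * B) p p.rev =
      B p p * sympForm r p p.rev * B p.rev p.rev := by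
    intro p
    rw [mul_sympForm_mul_apply, Finset.sum_eq_single p]
    · simp
    · intro a _ ha
      rcases lt_or_gt_of_ne ha with h1 | h1
      · rw [Matrix.transpose_apply, hB a p h1, zero_mul, zero_mul]
      · rw [hB a.rev p.rev (Fin.rev_lt_rev.2 h1), mul_zero]
    · simp
  constructor
  · ext p q
    by_cases hpq : q = p.rev
    · rw [hpq, hUd]
    · rw [sympForm_apply_of_ne hpq]
      rcases lt_or_gt_of_ne hpq with h1 | h1
      · rw [mul_sympForm_mul_apply]
        refine Finset.sum_eq_zero fun a _ => ?_
        by_cases h2 : p < a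
        · rw [Matrix.transpose_apply, hU a p h2, zero_mul, zero_mul]
        · rw [hU a.rev q (h1.trans_le (Fin.rev_le_rev.2 (not_lt.1 h2))), mul_zero]
      · rw [← h, mul_sympForm_mul_apply]
        refine Finset.sum_eq_zero fun a _ => ?_
        by_cases h2 : a < p
        · rw [Matrix.transpose_apply, hB a p h2, zero_mul, zero_mul]
        · rw [hB a.rev q ((Fin.rev_le_rev.2 (not_lt.1 h2)).trans_lt h1), mul_zero]
  · intro p
    have h1 := hBd p
    rw [h, hUd] at h1
    have h2 := sympForm_rev_ne_zero p
    have h3 : sympForm r p p.rev * (B p p * B p.rev p.rev) = sympForm r p p.rev * 1 := by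
      rw [mul_one]; conv_rhs => rw [h1]
      ring
    exact mul_left_cancel₀ h2 h3

theorem inv_val {r : ℕ} (g : Sp r) :
    (g⁻¹).val.val = -(sympForm r * (g.val.val)ᵀ * sympForm r) := by
  have h : (-(sympForm r * (g.val.val)ᵀ * sympForm r)) * g.val.val = 1 := by
    have hg : (g.val.val)ᵀ * sympForm r * g.val.val = sympForm r := g.2
    rw [Matrix.neg_mul, Matrix.mul_assoc, Matrix.mul_assoc, ← Matrix.mul_assoc (g.val.val)ᵀ, hg,
      sympForm_mul_self, neg_neg]
  have h' : g.val.val * (g⁻¹).val.val = 1 := by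
    change (g * g⁻¹).val.val = 1
    rw [mul_inv_cancel]; rfl
  exact (left_inv_eq_right_inv h h').symm

theorem entry_inv {r : ℕ} (g : Sp r) (p q : Fin (2 * r)) :
    entry g⁻¹ p q = -(sympForm r p p.rev * entry g q.rev p.rev * sympForm r q.rev q) := by
  have h1 : ∀ X : Matrix (Fin (2 * r)) (Fin (2 * r)) ℂ, ∀ a b,
      (sympForm r * X) a b = sympForm r a a.rev * X a.rev b := by
    intro X a b
    rw [Matrix.mul_apply, Finset.sum_eq_single a.rev]
    · intro c _ hc
      rw [sympForm_apply_of_ne hc, zero_mul]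
    · simp
  have h2 : ∀ X : Matrix (Fin (2 * r)) (Fin (2 * r)) ℂ, ∀ a b,
      (X * sympForm r) a b = X a b.rev * sympForm r b.rev b := by
    intro X a b
    rw [Matrix.mul_apply, Finset.sum_eq_single b.rev]
    · intro c _ hc
      rw [sympForm_apply_of_ne (fun h => hc (by rw [h, Fin.rev_rev])), mul_zero]
    · simp
  rw [entry, inv_val, Matrix.neg_apply, h2, h1, Matrix.transpose_apply]
  rfl

theorem inv_mem_unipN {r : ℕ} {g : Sp r} (hg : g ∈ unipN r) : g⁻¹ ∈ unipN r := by
  refine ⟨fun p => ?_, fun p q hqp => ?_⟩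
  · rw [entry_inv, hg.1, mul_one, sympForm_rev_mul, neg_neg]
  · rw [entry_inv, hg.2 _ _ (Fin.rev_lt_rev.2 hqp)]
    simp

theorem inv_mem_torusH {r : ℕ} {g : Sp r} (hg : g ∈ torusH r) : g⁻¹ ∈ torusH r := by
  intro p q hpq
  rw [entry_inv, hg _ _ (fun h => hpq (Fin.rev_injective h).symm)]
  simp

theorem mul_mem_torusH {r : ℕ} {g h : Sp r} (hg : g ∈ torusH r) (hh : h ∈ torusH r) :
    g * h ∈ torusH r := by
  intro p q hpq
  change (g.val.val * h.val.val) p q = 0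
  rw [Matrix.mul_apply]
  refine Finset.sum_eq_zero fun a _ => ?_
  by_cases ha : p = a
  · subst ha
    have := hh p q hpq
    rw [entry] at this
    rw [this, mul_zero]
  · have := hg p a ha
    rw [entry] at this
    rw [this, zero_mul]

/-- A symplectic matrix with nonzero leading minors lies in `N_- H N`. -/
theorem exists_gauss_decomposition {r : ℕ} (g : Sp r)
    (hg : ∀ k (hk : k ≤ 2 * r),
      (g.val.val.submatrix (Fin.castLE hk) (Fin.castLE hk)).det ≠ 0) :
    ∃ nm ∈ unipNMinus r, ∃ a ∈ torusH r, ∃ np ∈ unipN r, g = nm * a * np := by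
  obtain ⟨U, hU1, hU, hB, hBd⟩ := exists_upper_mul_lower g.val.val hg
  have hgs : (g.val.val)ᵀ * sympForm r * g.val.val = sympForm r := g.2
  have h : (g.val.val * U)ᵀ * sympForm r * (g.val.val * U) = Uᵀ * sympForm r * U := by
    calc (g.val.val * U)ᵀ * sympForm r * (g.val.val * U)
        = Uᵀ * ((g.val.val)ᵀ * sympForm r * g.val.val) * U := by
          rw [Matrix.transpose_mul]; simp only [Matrix.mul_assoc]
      _ = _ := by rw [hgs]
  obtain ⟨hUs, hBB⟩ := upper_lower_symp hU1 hU hB h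
  have hDs : (Matrix.diagonal fun p => (g.val.val * U) p p)ᵀ * sympForm r *
      (Matrix.diagonal fun p => (g.val.val * U) p p) = sympForm r := by
    ext p q
    rw [Matrix.diagonal_transpose, Matrix.mul_diagonal, Matrix.diagonal_mul]
    by_cases hpq : q = p.rev
    · subst hpq
      rw [mul_right_comm, hBB, one_mul]
    · rw [sympForm_apply_of_ne hpq]; simp
  have hu : toSp U hUs ∈ unipN r := ⟨hU1, hU⟩
  obtain ⟨a, ha⟩ : ∃ a : Sp r, a = toSp _ hDs := ⟨_, rfl⟩
  have haH : a ∈ torusH r := by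
    rw [ha]
    intro p q hpq
    exact Matrix.diagonal_apply_ne _ hpq
  refine ⟨g * toSp U hUs * a⁻¹, ?_, a, haH, (toSp U hUs)⁻¹, inv_mem_unipN hu, by simp⟩
  have he : ∀ p q, entry (g * toSp U hUs * a⁻¹) p q * (g.val.val * U) q q =
      (g.val.val * U) p q := by
    intro p q
    have e1 : (g * toSp U hUs * a⁻¹).val.val * a.val.val = g.val.val * U := by
      change (g * toSp U hUs * a⁻¹ * a).val.val = _
      rw [inv_mul_cancel_right]; rfl
    have e2 : a.val.val = Matrix.diagonal fun p => (g.val.val * U) p p := by rw [ha]; rfl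
    rw [e2] at e1
    have e3 := congrFun (congrFun e1 p) q
    rwa [Matrix.mul_diagonal] at e3
  refine ⟨fun p => ?_, fun p q hpq => ?_⟩
  · have := he p p
    exact mul_right_cancel₀ (hBd p) (by rw [this, one_mul])
  · have := he p q
    rw [hB p q hpq] at this
    exact (mul_eq_zero.1 this).resolve_right (hBd q)

theorem submatrix_mul_of_lower {n k : ℕ} (hk : k ≤ n) (A B : Matrix (Fin n) (Fin n) ℂ)
    (hA : ∀ p q, p < q → A p q = 0) :
    (A * B).submatrix (Fin.castLE hk) (Fin.castLE hk) =
      A.submatrix (Fin.castLE hk) (Fin.castLE hk) *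
        B.submatrix (Fin.castLE hk) (Fin.castLE hk) := by
  ext i j
  rw [Matrix.submatrix_apply, Matrix.mul_apply, Matrix.mul_apply]
  refine sum_eq_sum_castLE hk _ fun s hs => ?_
  rw [hA _ s (by rw [Fin.lt_def, Fin.val_castLE]; have := i.isLt; omega), zero_mul]

theorem rowMinor_rowsOf_val {d L : ℕ} (hd : d ≤ L) (A : Matrix (Fin L) (Fin L) ℂ) :
    rowMinor (rowsOf hd A) (fun i => i.val) =
      (A.submatrix (Fin.castLE hd) (Fin.castLE hd)).det := by
  unfold rowMinor
  congr 1
  ext i j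
  rw [Matrix.of_apply, rowsOf_apply hd _ (i.isLt.trans_le hd)]
  rfl

/-- The leading minors compute the fundamental characters on `N_- H N`. -/
theorem leading_minor_gauss {r : ℕ} (i : Fin r) (hi : i.val + 1 ≤ 2 * r) {nm a np : Sp r}
    (hnm : nm ∈ unipNMinus r) (ha : a ∈ torusH r) (hnp : np ∈ unipN r) :
    ((nm * a * np).val.val.submatrix (Fin.castLE hi) (Fin.castLE hi)).det = fundChar i a := by
  have e : (nm * a * np).val.val = nm.val.val * (a.val.val * np.val.val) := by
    rw [mul_assoc]; rfl
  have h1 : (nm.val.val.submatrix (Fin.castLE hi) (Fin.castLE hi)).det = 1 := by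
    rw [det_of_forall_lt_eq_zero]
    · exact Finset.prod_eq_one fun p _ => hnm.1 _
    · exact fun p q h => hnm.2 _ _ h
  have h2 : (np.val.val.submatrix (Fin.castLE hi) (Fin.castLE hi)).det = 1 := by
    rw [det_of_forall_gt_eq_zero]
    · exact Finset.prod_eq_one fun p _ => hnp.1 _
    · exact fun p q h => hnp.2 _ _ h
  have h3 : (a.val.val.submatrix (Fin.castLE hi) (Fin.castLE hi)).det = fundChar i a := by
    have hl : ∀ p q : Fin (i.val + 1), p < q →
        a.val.val.submatrix (Fin.castLE hi) (Fin.castLE hi) p q = 0 :=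
      fun p q h => ha _ _ (fun h' => h.ne (Fin.castLE_injective hi h'))
    rw [det_of_forall_lt_eq_zero _ hl, fundChar]
    refine Finset.prod_bij' (fun (p : Fin (i.val + 1)) _ => (⟨p.val, by omega⟩ : Fin r))
      (fun j hj => ⟨j.val, by
        have : j ≤ i := Finset.mem_Iic.1 hj
        rw [Fin.le_def] at this
        omega⟩) ?_ ?_ ?_ ?_ ?_
    · intro p _
      rw [Finset.mem_Iic, Fin.le_def]
      exact Nat.lt_succ_iff.1 p.isLt
    · intros; exact Finset.mem_univ _
    · intros; rfl
    · intros; rfl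
    · intros; rfl
  rw [e, submatrix_mul_of_lower hi nm.val.val _ (fun p q h => hnm.2 p q h),
    submatrix_mul_of_lower hi a.val.val _ (fun p q h => ha p q h.ne), Matrix.det_mul, Matrix.det_mul,
    h1, h2, h3, one_mul, mul_one]

/-- A curve in `Sp_{2r}(ℂ)` all of whose matrix entries are polynomials in the parameter. -/
def IsPolyCurve {r : ℕ} (γ : ℂ → Sp r) : Prop :=
  ∃ P : Matrix (Fin (2 * r)) (Fin (2 * r)) (Polynomial ℂ), ∀ t p q,
    entry (γ t) p q = (P p q).eval t

theorem isPolyCurve_const {r : ℕ} (g : Sp r) : IsPolyCurve fun _ => g :=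
  ⟨Matrix.of fun p q => Polynomial.C (entry g p q), fun t p q => by simp⟩

theorem IsPolyCurve.mul {r : ℕ} {γ δ : ℂ → Sp r} (hγ : IsPolyCurve γ) (hδ : IsPolyCurve δ) :
    IsPolyCurve fun t => γ t * δ t := by
  obtain ⟨P, hP⟩ := hγ
  obtain ⟨Q, hQ⟩ := hδ
  refine ⟨P * Q, fun t p q => ?_⟩
  rw [Matrix.mul_apply, Polynomial.eval_finsetSum]
  change ((γ t).val.val * (δ t).val.val) p q = _
  rw [Matrix.mul_apply]
  refine Finset.sum_congr rfl fun a _ => ?_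
  rw [Polynomial.eval_mul, ← hP, ← hQ]
  rfl

theorem IsPolyCurve.inv {r : ℕ} {γ : ℂ → Sp r} (hγ : IsPolyCurve γ) :
    IsPolyCurve fun t => (γ t)⁻¹ := by
  obtain ⟨P, hP⟩ := hγ
  refine ⟨Matrix.of fun p q => -(Polynomial.C (sympForm r p p.rev) * P q.rev p.rev *
    Polynomial.C (sympForm r q.rev q)), fun t p q => ?_⟩
  rw [entry_inv, hP]
  simp

/-- `g` lies at `t = 1` on a polynomial curve that meets the torus at `t = 0`. -/
def ContractsToTorus {r : ℕ} (g : Sp r) : Prop :=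
  ∃ γ : ℂ → Sp r, IsPolyCurve γ ∧ γ 1 = g ∧ γ 0 ∈ torusH r

theorem contractsToTorus_of_mem {r : ℕ} {g : Sp r} (hg : g ∈ torusH r) : ContractsToTorus g :=
  ⟨fun _ => g, isPolyCurve_const g, rfl, hg⟩

theorem ContractsToTorus.mul {r : ℕ} {g h : Sp r} (hg : ContractsToTorus g)
    (hh : ContractsToTorus h) : ContractsToTorus (g * h) := by
  obtain ⟨γ, h1, h2, h3⟩ := hg
  obtain ⟨δ, h4, h5, h6⟩ := hh
  exact ⟨fun t => γ t * δ t, h1.mul h4, by simp only [h2, h5], mul_mem_torusH h3 h6⟩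

theorem ContractsToTorus.inv {r : ℕ} {g : Sp r} (hg : ContractsToTorus g) :
    ContractsToTorus g⁻¹ := by
  obtain ⟨γ, h1, h2, h3⟩ := hg
  exact ⟨fun t => (γ t)⁻¹, h1.inv, by simp only [h2], inv_mem_torusH h3⟩

theorem one_mem_torusH {r : ℕ} : (1 : Sp r) ∈ torusH r := fun _ _ h => Matrix.one_apply_ne h

theorem contractsToTorus_prod {r : ℕ} (l : List (Sp r)) (h : ∀ g ∈ l, ContractsToTorus g) :
    ContractsToTorus l.prod := by
  induction l with
  | nil => exact contractsToTorus_of_mem one_mem_torusH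
  | cons a l ih =>
    rw [List.prod_cons]
    exact (h a (by simp)).mul (ih fun g hg => h g (by simp [hg]))

theorem contractsToTorus_of_linear {r : ℕ} (X : Matrix (Fin (2 * r)) (Fin (2 * r)) ℂ)
    (γ : ℂ → Sp r) (hγ : ∀ t, (γ t).val.val = 1 + t • X) (c : ℂ) : ContractsToTorus (γ c) := by
  refine ⟨fun t => γ (t * c), ⟨Matrix.of fun p q =>
    Polynomial.C ((1 : Matrix (Fin (2 * r)) (Fin (2 * r)) ℂ) p q) +
      Polynomial.X * Polynomial.C (c * X p q), fun t p q => ?_⟩, by simp only [one_mul], ?_⟩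
  · rw [entry, hγ]
    simp [mul_assoc]
  · intro p q hpq
    rw [entry, hγ]
    simp [hpq]

theorem contractsToTorus_xNeg {r : ℕ} (i : Fin r) (t : ℂˣ) : ContractsToTorus (xNeg i t) :=
  (contractsToTorus_of_linear (fMat i) (yNeg i) (yNeg_val i) t).mul
    (contractsToTorus_of_mem fun _ _ h => Matrix.diagonal_apply_ne _ h)

theorem contractsToTorus_sBar {r : ℕ} (i : Fin r) : ContractsToTorus (sBar i) :=
  ((contractsToTorus_of_linear (eMat i) (xPos i) (xPos_val i) _).mul
    (contractsToTorus_of_linear (fMat i) (yNeg i) (yNeg_val i) _)).mul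
    (contractsToTorus_of_linear (eMat i) (xPos i) (xPos_val i) _)

theorem contractsToTorus_weylRep {r : ℕ} (w : List (Fin r)) : ContractsToTorus (weylRep w) := by
  refine contractsToTorus_prod _ fun g hg => ?_
  obtain ⟨i, -, rfl⟩ := List.mem_map.1 hg
  exact contractsToTorus_sBar i

theorem contractsToTorus_xL {r : ℕ} (w : List (Fin r)) (Y : Fin w.length → ℂˣ) :
    ContractsToTorus (xL w Y) := by
  refine contractsToTorus_prod _ fun g hg => ?_
  obtain ⟨p, rfl⟩ := (List.mem_ofFn' _ _).1 hg
  exact contractsToTorus_xNeg _ _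

theorem IsRegularFun.exists_poly {r : ℕ} {D : Sp r → ℂ} (hD : IsRegularFun D) {γ : ℂ → Sp r}
    (hγ : IsPolyCurve γ) : ∃ f : Polynomial ℂ, ∀ t, D (γ t) = f.eval t := by
  obtain ⟨P, hP⟩ := hD
  obtain ⟨Q, hQ⟩ := hγ
  refine ⟨MvPolynomial.aeval (fun pq => Q pq.1 pq.2) P, fun t => ?_⟩
  rw [hP, ← Polynomial.coe_evalRingHom, MvPolynomial.aeval_def, MvPolynomial.hom_eval₂,
    MvPolynomial.eval, MvPolynomial.coe_eval₂Hom]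
  congr 1
  · ext; simp
  · funext pq
    simp [hQ]

/-- Regular functions that agree on the translate `h N_- H N` agree at `h g` if `g` contracts to the
torus, because the curve through `g` meets the open cell for almost all parameters. -/
theorem regular_eq_of_contractsToTorus {r : ℕ} {D D' : Sp r → ℂ} (hD : IsRegularFun D)
    (hD' : IsRegularFun D') (h g : Sp r) (hg : ContractsToTorus g)
    (heq : ∀ nm ∈ unipNMinus r, ∀ a ∈ torusH r, ∀ np ∈ unipN r,
      D (h * (nm * a * np)) = D' (h * (nm * a * np))) : D (h * g) = D' (h * g) := by
  obtain ⟨γ, hγ, rfl, h0⟩ := hg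
  obtain ⟨f, hf⟩ := hD.exists_poly ((isPolyCurve_const h).mul hγ)
  obtain ⟨f', hf'⟩ := hD'.exists_poly ((isPolyCurve_const h).mul hγ)
  obtain ⟨P, hP⟩ := hγ
  obtain ⟨Q, hQ⟩ : ∃ Q : Polynomial ℂ, Q = ∏ k : Fin (2 * r + 1),
    (P.submatrix (Fin.castLE (Nat.lt_succ_iff.1 k.isLt))
      (Fin.castLE (Nat.lt_succ_iff.1 k.isLt))).det := ⟨_, rfl⟩
  have hdet : ∀ t k (hk : k ≤ 2 * r),
      (P.submatrix (Fin.castLE hk) (Fin.castLE hk)).det.eval t =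
        ((γ t).val.val.submatrix (Fin.castLE hk) (Fin.castLE hk)).det := by
    intro t k hk
    rw [← Polynomial.coe_evalRingHom, RingHom.map_det]
    congr 1
    ext p q
    exact (hP t _ _).symm
  have hQ0 : Q ≠ 0 := by
    intro hQ'
    have : Q.eval 0 = 0 := by rw [hQ', Polynomial.eval_zero]
    rw [hQ, Polynomial.eval_prod, Finset.prod_eq_zero_iff] at this
    obtain ⟨k, -, hk⟩ := this
    have hlow : ∀ p q : Fin k.val, p < q → (γ 0).val.val.submatrix
        (Fin.castLE (Nat.lt_succ_iff.1 k.isLt)) (Fin.castLE (Nat.lt_succ_iff.1 k.isLt)) p q = 0 :=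
      fun p q hpq => h0 _ _ (fun h' => hpq.ne (Fin.castLE_injective _ h'))
    rw [hdet, det_of_forall_lt_eq_zero _ hlow, Finset.prod_eq_zero_iff] at hk
    obtain ⟨p, -, hp⟩ := hk
    have hone : γ 0 * (γ 0)⁻¹ = 1 := mul_inv_cancel _
    have hone' : ((γ 0).val.val * ((γ 0)⁻¹).val.val) (Fin.castLE (Nat.lt_succ_iff.1 k.isLt) p)
        (Fin.castLE (Nat.lt_succ_iff.1 k.isLt) p) = 1 := by
      change (γ 0 * (γ 0)⁻¹).val.val _ _ = 1
      rw [hone]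
      exact Matrix.one_apply_eq _
    rw [Matrix.mul_apply, Finset.sum_eq_zero] at hone'
    · exact zero_ne_one hone'
    · intro b _
      by_cases hb : Fin.castLE (Nat.lt_succ_iff.1 k.isLt) p = b
      · rw [← hb]
        rw [Matrix.submatrix_apply] at hp
        rw [hp, zero_mul]
      · have := h0 _ _ hb
        rw [entry] at this
        rw [this, zero_mul]
  have hmul : (f - f') * Q = 0 := by
    refine Polynomial.funext fun t => ?_
    rw [Polynomial.eval_mul, Polynomial.eval_zero, mul_eq_zero]
    by_cases ht : Q.eval t = 0
    · exact Or.inr ht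
    · left
      rw [hQ, Polynomial.eval_prod, Finset.prod_eq_zero_iff] at ht
      push Not at ht
      obtain ⟨nm, hnm, a, ha, np, hnp, e⟩ := exists_gauss_decomposition (γ t) (fun k hk => by
        rw [← hdet]
        exact ht ⟨k, Nat.lt_succ_iff.2 hk⟩ (Finset.mem_univ _))
      rw [Polynomial.eval_sub, ← hf, ← hf', e, heq nm hnm a ha np hnp, sub_self]
  have hff : f = f' := sub_eq_zero.1 ((mul_eq_zero.1 hmul).resolve_right hQ0)
  rw [hf 1, hf' 1, hff]

/-- The leading minor of size `i + 1` (the fundamental weight `Λ_i` is zero-based) of `w̄⁻¹ x`. -/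
noncomputable def leadingMinor {r : ℕ} (w : List (Fin r)) (i : Fin r) (x : Sp r) : ℂ :=
  (((weylRep w)⁻¹ * x).val.val.submatrix (Fin.castLE (by omega : i.val + 1 ≤ 2 * r))
    (Fin.castLE (by omega : i.val + 1 ≤ 2 * r))).det

theorem isGeneralizedMinor_leadingMinor {r : ℕ} (w : List (Fin r)) (i : Fin r) :
    IsGeneralizedMinor w [] i (leadingMinor w i) := by
  refine ⟨⟨Matrix.det (Matrix.of fun (p q : Fin (i.val + 1)) => ∑ s,
    MvPolynomial.C (entry (weylRep w)⁻¹ (Fin.castLE (by omega) p) s) *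
      MvPolynomial.X (s, Fin.castLE (by omega) q)), fun g => ?_⟩, ?_⟩
  · rw [RingHom.map_det, leadingMinor]
    congr 1
    ext p q
    simp only [RingHom.mapMatrix_apply, Matrix.map_apply, Matrix.of_apply, map_sum, map_mul,
      MvPolynomial.eval_C, MvPolynomial.eval_X, Matrix.submatrix_apply]
    change ((weylRep w)⁻¹.val.val * g.val.val) _ _ = _
    rw [Matrix.mul_apply]
    rfl
  · intro x nm hnm a ha np hnp h
    have : weylRep ([] : List (Fin r)) = 1 := rfl
    rw [this, mul_one] at h
    rw [leadingMinor, h]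
    exact leading_minor_gauss i _ hnm ha hnp

theorem IsGeneralizedMinor.eq_leadingMinor {r : ℕ} {w : List (Fin r)} {i : Fin r} {D : Sp r → ℂ}
    (hD : IsGeneralizedMinor w [] i D) {x : Sp r} (hx : ContractsToTorus x) :
    D x = leadingMinor w i x := by
  have h0 := isGeneralizedMinor_leadingMinor w i
  have := regular_eq_of_contractsToTorus hD.1 h0.1 (weylRep w) ((weylRep w)⁻¹ * x)
    ((contractsToTorus_weylRep w).inv.mul hx) (fun nm hnm a ha np hnp => by
      have e : (weylRep w)⁻¹ * (weylRep w * (nm * a * np)) * weylRep [] = nm * a * np := by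
        have : weylRep ([] : List (Fin r)) = 1 := rfl
        rw [this, mul_one, inv_mul_cancel_left]
      rw [hD.2 _ nm hnm a ha np hnp e, h0.2 _ nm hnm a ha np hnp e])
  rwa [mul_inv_cancel_left] at this

/-! ### Laurent monomials and conclusion -/

/-- Laurent monomials with coefficient `1`, as functions on `(ℂˣ)^n`. -/
def IsLaurentMonomial {n : ℕ} (F : (Fin n → ℂˣ) → ℂ) : Prop :=
  ∃ e : Fin n → ℤ, ∀ Y, F Y = ∏ p, ((Y p ^ e p : ℂˣ) : ℂ)

theorem isLaurentMonomial_one {n : ℕ} : IsLaurentMonomial fun _ : Fin n → ℂˣ => (1 : ℂ) :=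
  ⟨0, fun Y => by simp⟩

theorem isLaurentMonomial_coord {n : ℕ} (j : Fin n) :
    IsLaurentMonomial fun Y : Fin n → ℂˣ => (Y j : ℂ) := by
  refine ⟨Pi.single j 1, fun Y => ?_⟩
  rw [Finset.prod_eq_single j]
  · simp
  · intro p _ hp
    simp [Pi.single_eq_of_ne hp]
  · simp

theorem IsLaurentMonomial.div {n : ℕ} {F G : (Fin n → ℂˣ) → ℂ} (hF : IsLaurentMonomial F)
    (hG : IsLaurentMonomial G) : IsLaurentMonomial fun Y => F Y / G Y := by
  obtain ⟨e, he⟩ := hF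
  obtain ⟨f, hf⟩ := hG
  refine ⟨e - f, fun Y => ?_⟩
  simp only [he, hf, ← Finset.prod_div_distrib]
  refine Finset.prod_congr rfl fun p _ => ?_
  rw [← Units.val_div_eq_div_val, div_eq_mul_inv, ← zpow_sub]
  rfl

theorem IsLaurentMonomial.prod {n : ℕ} {ι : Type*} (s : Finset ι) (F : ι → (Fin n → ℂˣ) → ℂ)
    (hF : ∀ i, IsLaurentMonomial (F i)) : IsLaurentMonomial fun Y => ∏ i ∈ s, F i Y := by
  choose e he using hF
  refine ⟨∑ i ∈ s, e i, fun Y => ?_⟩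
  simp only [he, Finset.sum_apply]
  rw [Finset.prod_comm]
  refine Finset.prod_congr rfl fun p _ => ?_
  classical
  induction s using Finset.induction_on with
  | empty => simp
  | insert a s ha ih =>
    rw [Finset.prod_insert ha, Finset.sum_insert ha, ih, ← Units.val_mul, zpow_add]

theorem isNonnegLaurent_sum {n : ℕ} {ι : Type*} (s : Finset ι) (F : ι → (Fin n → ℂˣ) → ℂ)
    (hF : ∀ i, IsLaurentMonomial (F i)) : IsNonnegLaurent fun Y => ∑ i ∈ s, F i Y := by
  classical
  choose e he using hF
  refine ⟨∑ i ∈ s, Finsupp.single (e i) 1, fun Y => ?_⟩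
  rw [← Finsupp.sum_finsetSum_index]
  · refine Finset.sum_congr rfl fun i _ => ?_
    rw [Finsupp.sum_single_index]
    · rw [he]; simp
    · simp
  · simp
  · intro a b c
    push_cast
    ring

theorem isLaurentMonomial_Yc {r : ℕ} (w : List (Fin r)) (s l : ℤ) :
    IsLaurentMonomial fun Y => Yc w Y s l := by
  unfold Yc
  split_ifs
  · exact isLaurentMonomial_coord _
  · exact isLaurentMonomial_one

theorem isLaurentMonomial_arrayMonomial {r m M d : ℕ} (w : List (Fin r))
    (K : Fin M → Fin d → Fin (2 * r)) :
    IsLaurentMonomial fun Y => arrayMonomial m w Y K := by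
  unfold arrayMonomial
  refine IsLaurentMonomial.prod _ _ fun i => IsLaurentMonomial.prod _ _ fun s => ?_
  split_ifs
  · exact (isLaurentMonomial_Yc _ _ _).div (isLaurentMonomial_Yc _ _ _)
  · exact (isLaurentMonomial_Yc _ _ _).div (isLaurentMonomial_Yc _ _ _)

theorem leadingMinor_eq_rowMinor {r d : ℕ} (w : List (Fin r)) {i : Fin r} (hi : i.val + 1 = d)
    (hd : d ≤ 2 * r) (x : Sp r) :
    leadingMinor w i x = rowMinor (rowsOf hd ((weylRep w)⁻¹ * x).val.val) fun i => i.val := by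
  subst hi
  exact (rowMinor_rowsOf_val _ _).symm

/-- The position `k` is the letter `d` of the cycle `m'`. -/
theorem position_eq {r m d : ℕ} (hd : 1 ≤ d) (hdr : d ≤ r) (k : Fin (cycWord r m d).length)
    (hk : ((cycWord r m d).get k).val + 1 = d) {m' : ℕ} (h1 : (m' - 1) * r ≤ k.val)
    (h2 : k.val < m' * r) (hm : 1 ≤ m) :
    1 ≤ m' ∧ m' ≤ m ∧ k.val + 1 = (m' - 1) * r + d := by
  have hlt := k.isLt.trans_eq (length_cycWord hdr)
  rw [List.get_eq_getElem, getElem_cycWord hd hdr] at hk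
  have hm' : 1 ≤ m' := by
    by_contra h
    obtain rfl : m' = 0 := by omega
    simp at h2
  obtain ⟨q, rfl⟩ := Nat.exists_eq_add_of_le' hm'
  obtain ⟨p, rfl⟩ := Nat.exists_eq_add_of_le' hm
  simp only [Nat.add_sub_cancel] at h1 hlt ⊢
  refine ⟨hm', ?_, ?_⟩
  · by_contra h
    have : (p + 1) * r ≤ q * r := Nat.mul_le_mul_right _ (by omega)
    rw [Nat.add_mul] at this
    omega
  · have : k.val = q * r + (k.val - q * r) := by omega
    rw [this, Nat.mul_add_mod_of_lt (by rw [Nat.add_mul] at h2; omega)] at hk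
    omega

end TypeC

open TypeC
theorem theorem5p7 (r m d : ℕ) (hm : 1 ≤ m) (hmr : m ≤ r) (hd : 1 ≤ d) (hdr : d ≤ r)
    (k : Fin (cycWord r m d).length)
    (hk : ((cycWord r m d).get k).val + 1 = d)
    (m' : ℕ) (hm'₁ : (m' - 1) * r ≤ k.val) (hm'₂ : k.val < m' * r) :
    (∃ D : Sp r → ℂ, IsInitialMinor (cycWord r m d) k D) ∧
    ∀ D : Sp r → ℂ, IsInitialMinor (cycWord r m d) k D →
      (∀ Y : Fin (cycWord r m d).length → ℂˣ,
        D (xL (cycWord r m d) Y) =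
          ∑ K : Fin (m - m') → Fin d → Fin (2 * r) with StarCond r m' (m - m') d K,
            arrayMonomial m (cycWord r m d) Y K) ∧
      IsNonnegLaurent (fun Y : Fin (cycWord r m d).length → ℂˣ => D (xL (cycWord r m d) Y)) := by
  obtain ⟨h1, h2, h3⟩ := position_eq hd hdr k hk hm'₁ hm'₂ hm
  refine ⟨⟨_, isGeneralizedMinor_leadingMinor _ _⟩, fun D hD => ?_⟩
  have hmain : ∀ Y : Fin (cycWord r m d).length → ℂˣ,
      D (xL (cycWord r m d) Y) =
        ∑ K : Fin (m - m') → Fin d → Fin (2 * r) with StarCond r m' (m - m') d K,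
          arrayMonomial m (cycWord r m d) Y K := by
    intro Y
    rw [hD.eq_leadingMinor (contractsToTorus_xL _ Y),
      leadingMinor_eq_rowMinor _ hk (by omega : d ≤ 2 * r), h3,
      rowMinor_weylRep_inv_mul hd hdr h1 h2 hmr,
      rowMinor_xL hm hd hdr Y (strictMono_target hdr) (fun i => target_lt hdr i.isLt),
      arraySum_target h2 hmr hdr]
  refine ⟨hmain, ?_⟩
  simp only [hmain]
  exact isNonnegLaurent_sum _ _ fun K => isLaurentMonomial_arrayMonomial _ K
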